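/- Let $(A,\mathfrak n)$ be a regular local ring, and let $\mathfrak a=(x_1,\dots,x_d)$ and $\mathfrak b=(y_1,\dots,y_s)$, $s\ge 1$, be ideals of $A$ with $\operatorname{ht}\mathfrak a=d$ ($\mathfrak a$ is a complete intersection) and $\operatorname{ht}\mathfrak b=s-1$ ($\mathfrak b$ is an almost complete intersection; the $y_i$ need not generate $\mathfrak b$ minimally). Suppose that $x_1,\dots,x_d,y_1,\dots,y_{s-1}$ is a regular sequence of $A$ and that $\operatorname{ht}\mathfrak a+\operatorname{ht}\mathfrak b=d+s-1=\dim A$. Put $R:=A/\mathfrak b$ and $R/\mathfrak a:=A/(\mathfrak a+\mathfrak b)$. For a proper ideal $I$ of $A$ let $\omega_{A/I}:=\operatorname{Ext}_A^{\dim A-\dim A/I}(A/I,A)$ denote the canonical module of $A/I$, let $H_i(\mathbf x,M)$ denote the Koszul homology of $\mathbf x=x_1,\dots,x_d$ with coefficients in $M$, and let $\ell$ denote length. Then the following hold. (i) There is an exact sequence $$0\to H_2(\mathbf x,R)\to \omega_R/\mathfrak a\,\omega_R\to \omega_{R/\mathfrak a}\to H_1(\mathbf x,R)\to 0.$$ (ii)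 $H_i(\mathbf x,R)\cong H_{i-2}(\mathbf x,\omega_R)$ for every $i\ge 3$. Moreover, $\operatorname{depth}\omega_R=\operatorname{depth}R+2$ if $\operatorname{depth}R\le d-2$, and $\operatorname{depth}\omega_R=d$ if $\operatorname{depth}R\ge d-1$. (iii) The images of $x_1,\dots,x_d$ in $R$ form a system of parameters of $R$. This system satisfies the Monomial Conjecture, that is, $$x_1^t\cdots x_d^t\notin (x_1^{t+1},\dots,x_d^{t+1})R\quad\text{for every } t\ge 1,$$ if and only if $\ell\big(H_2(\mathbf x,R)\big)<\ell\big(\omega_R/\mathfrak a\,\omega_R\big)$. This is also equivalent to the map $\omega_R/\mathfrak a\,\omega_R\to\omega_{R/\mathfrak a}$ being non-zero, in any exact sequence of the form given in (i). -/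

import Mathlib

universe u

/-- The Koszul differential of `x₁, …, x_d` with coefficients in `M`. A family `m` indexed by the
subsets `S` of `{1, …, d}` stands for the Koszul chain `∑_S e_S ⊗ m S`, where `e_S` is the wedge of
the basis vectors `e_i`, `i ∈ S`, in increasing order. From
`∂ e_S = ∑_{i ∈ S} (-1) ^ #{j ∈ S | j < i} x_i e_{S \ {i}}` one gets the coefficient of `∂ m`
at `e_T`. -/
def koszulDifferential {A : Type*} [CommRing A] {d : ℕ} (x : Fin d → A)
    (M : Type*) [AddCommGroup M] [Module A M] :
    (Finset (Fin d) → M) →ₗ[A] (Finset (Fin d) → M) where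
  toFun m T := ∑ i ∈ Tᶜ, ((-1) ^ (T.filter (· < i)).card * x i) • m (insert i T)
  map_add' m m' := by
    funext T
    simp only [Pi.add_apply, smul_add, Finset.sum_add_distrib]
  map_smul' a m := by
    funext T
    simp only [Pi.smul_apply, RingHom.id_apply, Finset.smul_sum]
    exact Finset.sum_congr rfl fun i _ => smul_comm _ _ _

/-- The Koszul chains of degree `p`: those supported on the subsets with `p` elements. -/
def koszulChains (A : Type*) [CommRing A] (d : ℕ) (M : Type*) [AddCommGroup M] [Module A M]
    (p : ℕ) : Submodule A (Finset (Fin d) → M) where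
  carrier := {m | ∀ S, S.card ≠ p → m S = 0}
  add_mem' hm hm' S hS := by simp [hm S hS, hm' S hS]
  zero_mem' _ _ := rfl
  smul_mem' a _ hm S hS := by simp [hm S hS]

/-- The Koszul cycles of degree `p`. -/
def koszulCycles {A : Type*} [CommRing A] {d : ℕ} (x : Fin d → A)
    (M : Type*) [AddCommGroup M] [Module A M] (p : ℕ) : Submodule A (Finset (Fin d) → M) :=
  koszulChains A d M p ⊓ LinearMap.ker (koszulDifferential x M)

/-- The Koszul boundaries of degree `p`: the images of the chains of degree `p + 1`. -/
def koszulBoundaries {A : Type*} [CommRing A] {d : ℕ} (x : Fin d → A)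
    (M : Type*) [AddCommGroup M] [Module A M] (p : ℕ) : Submodule A (Finset (Fin d) → M) :=
  (koszulChains A d M (p + 1)).map (koszulDifferential x M)

/-- The Koszul differential squares to zero. -/
theorem koszulDifferential_koszulDifferential {A : Type*} [CommRing A] {d : ℕ} (x : Fin d → A)
    (M : Type*) [AddCommGroup M] [Module A M] (m : Finset (Fin d) → M) :
    koszulDifferential x M (koszulDifferential x M m) = 0 := by
  have key : ∀ (T : Finset (Fin d)) (i j : Fin d), i ∉ T → j ∉ T → i < j →
      ((-1 : A) ^ (T.filter (· < i)).card * x i) *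
          ((-1) ^ ((insert i T).filter (· < j)).card * x j) +
        ((-1) ^ (T.filter (· < j)).card * x j) *
          ((-1) ^ ((insert j T).filter (· < i)).card * x i) = 0 := by
    intro T i j hi hj hij
    rw [Finset.filter_insert, Finset.filter_insert, if_pos hij, if_neg hij.not_gt,
      Finset.card_insert_of_notMem (by simp [hi])]
    ring
  funext T
  simp only [koszulDifferential, LinearMap.coe_mk, AddHom.coe_mk, Finset.smul_sum, smul_smul,
    Pi.zero_apply]
  rw [Finset.sum_sigma']
  refine Finset.sum_involution (fun a _ => ⟨a.2, a.1⟩) ?_ ?_ ?_ ?_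
  · rintro ⟨i, j⟩ h
    simp only [Finset.mem_sigma, Finset.mem_compl, Finset.mem_insert, not_or] at h
    obtain ⟨hi, hji, hj⟩ := h
    dsimp only
    rw [Finset.insert_comm, ← add_smul]
    rcases lt_or_gt_of_ne hji with h | h
    · rw [add_comm, key T j i hj hi h, zero_smul]
    · rw [key T i j hi hj h, zero_smul]
  · rintro ⟨i, j⟩ h _ h'
    simp only [Finset.mem_sigma, Finset.mem_compl, Finset.mem_insert, not_or] at h
    simp only [Sigma.mk.injEq] at h'
    exact h.2.1 h'.1
  · rintro ⟨i, j⟩ h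
    simp only [Finset.mem_sigma, Finset.mem_compl, Finset.mem_insert, not_or] at h ⊢
    exact ⟨h.2.2, fun e => h.2.1 e.symm, h.1⟩
  · rintro ⟨i, j⟩ _
    rfl

/-- Boundaries are cycles. -/
theorem koszulBoundaries_le_koszulCycles {A : Type*} [CommRing A] {d : ℕ} (x : Fin d → A)
    (M : Type*) [AddCommGroup M] [Module A M] (p : ℕ) :
    koszulBoundaries x M p ≤ koszulCycles x M p := by
  rintro _ ⟨m, hm, rfl⟩
  refine ⟨fun T hT => ?_, koszulDifferential_koszulDifferential x M m⟩
  refine Finset.sum_eq_zero fun i hi => ?_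
  rw [hm (insert i T) ?_, smul_zero]
  rw [Finset.card_insert_of_notMem (Finset.mem_compl.mp hi)]
  omega

/-- The Koszul homology module `H_p(x₁, …, x_d; M)`. -/
abbrev KoszulHomology {A : Type*} [CommRing A] {d : ℕ} (x : Fin d → A)
    (M : Type*) [AddCommGroup M] [Module A M] (p : ℕ) : Type _ :=
  koszulCycles x M p ⧸ (koszulBoundaries x M p).submoduleOf (koszulCycles x M p)

/-- The depth of a module `M` over a local ring `A`: the supremum of the lengths of the
`M`-regular sequences in the maximal ideal. If `M` is a module over a quotient of `A`, the depth
over the quotient is the same number, as regular sequences can be lifted and mapped down. -/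
noncomputable def moduleDepth (A : Type*) [CommRing A] [IsLocalRing A]
    (M : Type*) [AddCommGroup M] [Module A M] : ℕ∞ :=
  ⨆ rs : {rs : List A // (∀ r ∈ rs, r ∈ IsLocalRing.maximalIdeal A) ∧
    RingTheory.Sequence.IsRegular M rs}, (rs.1.length : ℕ∞)

/-- The number `dim A - dim A/I`, for a nontrivial ring `A` of finite Krull dimension and a proper
ideal `I`. -/
noncomputable def quotientCodim {A : Type*} [CommRing A] (I : Ideal A) : ℕ :=
  ((ringKrullDim A).unbotD 0 - (ringKrullDim (A ⧸ I)).unbotD 0).toNat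

/-- The canonical module of `A ⧸ I`, for a regular local ring `A` and a proper ideal `I`:
`Ext_A^c(A/I, A)` with `c = dim A - dim A/I`. It is killed by `I`, and the module structures over
`A` and over `A ⧸ I` have the same submodules and the same linear maps. -/
noncomputable abbrev CanonicalModule {A : Type u} [CommRing A] (I : Ideal A) : Type u :=
  CategoryTheory.Abelian.Ext.{u} (ModuleCat.of A (A ⧸ I)) (ModuleCat.of A A) (quotientCodim I)

/-- `x₁, …, x_d` is a system of parameters of the local ring `R`. -/
def IsSystemOfParameters {R : Type*} [CommRing R] {d : ℕ} (x : Fin d → R) : Prop :=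
  ringKrullDim R = d ∧
    ∃ _ : IsLocalRing R, (Ideal.span (Set.range x)).radical = IsLocalRing.maximalIdeal R

/-- The sequence `x₁, …, x_d` satisfies the Monomial Conjecture:
`x₁ᵗ ⋯ x_dᵗ ∉ (x₁ᵗ⁺¹, …, x_dᵗ⁺¹)` for every `t ≥ 1`. -/
def SatisfiesMonomialConjecture {R : Type*} [CommRing R] {d : ℕ} (x : Fin d → R) : Prop :=
  ∀ t : ℕ, 1 ≤ t → ∏ i, x i ^ t ∉ Ideal.span (Set.range fun i => x i ^ (t + 1))

/-! ### Functoriality, lifting and truncation of Koszul chains. -/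

section KoszulBasic

variable {A : Type*} [CommRing A] {d : ℕ} (x : Fin d → A)
  {M N P : Type*} [AddCommGroup M] [Module A M] [AddCommGroup N] [Module A N]
  [AddCommGroup P] [Module A P]

/-! Put `S = A/(y₁, …, y_{s-1})` and `l = y_s`, so that `R = S/lS`. By Rees, Ext into `A` drops
along a regular sequence in the annihilator; hence `ω_R = Hom(R, S) = (0 :_S l)`, and likewise
`ω_{R/𝔞}` is the kernel of `l` on `S/𝔞S` (`nonempty_canonicalModule_equiv_ker`). Everything is read
off the exact sequence `0 → ω_R → S → S → R → 0` with middle map `l`.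

The sequence `x` is regular on `S`, so the Koszul homology of `S` vanishes in positive degrees.
Chasing through the sequence gives `H_{i+2}(R) ≅ H_i(ω_R)` for `i ≥ 1`
(`nonempty_koszulHomology_equiv`), and in low degrees the four-term sequence of (i)
(`exists_koszul_four_term_exact`). Depth is `d` minus the top degree of nonvanishing Koszul
homology, so the shift by two gives the depth formulas (`moduleDepth_eq_of_koszulAcyclic_shift`).

For (iii), the map `ω_R/𝔞ω_R → S/𝔞S` is nonzero iff some `a ∉ (x, y₁, …, y_{s-1})` has `l a ∈ (y₁,
…, y_{s-1})`. This is equivalent to the Monomial Conjecture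
(`IsParameterSystem.satisfiesMonomialConjecture_iff`). Given such an `a`, a relation violating the
conjecture, multiplied by `a`, would put `a` in `(x, y₁, …, y_{s-1})`, because `x, y₁, …, y_{s-1}`
is a system of parameters of a Cohen–Macaulay ring. If there is none, Artin–Rees shows that for some
`t ≥ 1` the annihilator of `l` in the Gorenstein Artinian ring `A/(x₁^{t+1}, …, x_d^{t+1}, y₁, …,
y_{s-1})` is killed by `x₁^t ⋯ x_d^t`; the double annihilator property then puts this product in the
ideal of `l`. The length criterion is finite length plus exactness. -/

theorem koszulDifferential_apply (m : Finset (Fin d) → M) (T : Finset (Fin d)) :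
    koszulDifferential x M m T =
      ∑ i, if i ∈ T then 0 else ((-1) ^ (T.filter (· < i)).card * x i) • m (insert i T) := by
  change ∑ i ∈ Tᶜ, _ = _
  rw [← Finset.sum_subset (Finset.subset_univ Tᶜ)]
  · exact Finset.sum_congr rfl fun i hi => (if_neg (Finset.mem_compl.mp hi)).symm
  · intro i _ hi
    exact if_pos (by simpa using hi)

theorem koszulDifferential_compLeft (f : M →ₗ[A] N) (m : Finset (Fin d) → M) :
    koszulDifferential x N (f.compLeft _ m) = f.compLeft _ (koszulDifferential x M m) := by
  funext T
  simp [koszulDifferential]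

theorem compLeft_mem_koszulChains (f : M →ₗ[A] N) {p : ℕ} {m : Finset (Fin d) → M}
    (hm : m ∈ koszulChains A d M p) : f.compLeft _ m ∈ koszulChains A d N p := by
  intro S hS
  simp [hm S hS]

theorem koszulDifferential_mem_koszulChains {p : ℕ} {m : Finset (Fin d) → M}
    (hm : m ∈ koszulChains A d M (p + 1)) :
    koszulDifferential x M m ∈ koszulChains A d M p :=
  (koszulBoundaries_le_koszulCycles x M p ⟨m, hm, rfl⟩).1

theorem koszulDifferential_eq_zero_of_mem_koszulChains_zero {m : Finset (Fin d) → M}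
    (hm : m ∈ koszulChains A d M 0) : koszulDifferential x M m = 0 := by
  funext T
  refine Finset.sum_eq_zero fun i _ => ?_
  rw [hm _ (Finset.card_ne_zero_of_mem (Finset.mem_insert_self i T)), smul_zero]

theorem eq_zero_of_mem_koszulChains_of_lt {p : ℕ} (hp : d < p) {m : Finset (Fin d) → M}
    (hm : m ∈ koszulChains A d M p) : m = 0 := by
  funext S
  refine hm S fun h => ?_
  have := S.card_le_univ
  simp at this
  omega

theorem exists_koszulChain_lift (f : M →ₗ[A] N) {p : ℕ} {n : Finset (Fin d) → N}
    (hn : n ∈ koszulChains A d N p) (h : ∀ S, n S ∈ LinearMap.range f) :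
    ∃ m ∈ koszulChains A d M p, f.compLeft _ m = n := by
  choose m hm using h
  refine ⟨fun S => if S.card = p then m S else 0, fun S hS => if_neg hS, ?_⟩
  funext S
  by_cases hS : S.card = p
  · simp [hS, hm]
  · simp [hS, hn S hS]

theorem exists_koszulChain_lift_of_surjective {f : M →ₗ[A] N} (hf : Function.Surjective f)
    {p : ℕ} {n : Finset (Fin d) → N} (hn : n ∈ koszulChains A d N p) :
    ∃ m ∈ koszulChains A d M p, f.compLeft _ m = n :=
  exists_koszulChain_lift f hn fun S => hf (n S)

theorem exists_koszulChain_lift_of_exact {f : M →ₗ[A] N} {g : N →ₗ[A] P}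
    (h : Function.Exact f g) {p : ℕ} {n : Finset (Fin d) → N} (hn : n ∈ koszulChains A d N p)
    (hg : g.compLeft _ n = 0) : ∃ m ∈ koszulChains A d M p, f.compLeft _ m = n :=
  exists_koszulChain_lift f hn fun S => (h (n S)).mp (congrFun hg S)

theorem compLeft_injective {f : M →ₗ[A] N} (hf : Function.Injective f) :
    Function.Injective (f.compLeft (Finset (Fin d))) := fun _ _ h =>
  funext fun S => hf (congrFun h S)

/-- Truncation of a family to the subsets with `p` elements. -/
theorem exists_koszulChain_differential_eq {p : ℕ} {m c : Finset (Fin d) → M}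
    (hm : m ∈ koszulChains A d M p) (h : koszulDifferential x M c = m) :
    ∃ c' ∈ koszulChains A d M (p + 1), koszulDifferential x M c' = m := by
  refine ⟨fun S => if S.card = p + 1 then c S else 0, fun S hS => if_neg hS, ?_⟩
  funext T
  by_cases hT : T.card = p
  · rw [← h]
    refine Finset.sum_congr rfl fun i hi => ?_
    have hc : (insert i T).card = p + 1 := by
      rw [Finset.card_insert_of_notMem (Finset.mem_compl.mp hi), hT]
    simp only [hc, if_true]
  · rw [hm T hT]
    refine Finset.sum_eq_zero fun i hi => ?_
    have hc : (insert i T).card ≠ p + 1 := by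
      rw [Finset.card_insert_of_notMem (Finset.mem_compl.mp hi)]
      omega
    simp only [hc, if_false, smul_zero]

/-- The vanishing of the Koszul homology in degree `p`. -/
def KoszulAcyclic (M : Type*) [AddCommGroup M] [Module A M] (p : ℕ) : Prop :=
  ∀ m ∈ koszulChains A d M p, koszulDifferential x M m = 0 →
    ∃ c ∈ koszulChains A d M (p + 1), koszulDifferential x M c = m

variable {x} in
theorem KoszulAcyclic.of_lt {p : ℕ} (hp : d < p) : KoszulAcyclic x M p := fun m hm _ =>
  ⟨0, zero_mem _, by rw [map_zero, eq_zero_of_mem_koszulChains_of_lt hp hm]⟩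

theorem koszulAcyclic_iff_subsingleton (M : Type*) [AddCommGroup M] [Module A M] (p : ℕ) :
    KoszulAcyclic x M p ↔ Subsingleton (KoszulHomology x M p) := by
  rw [Submodule.Quotient.subsingleton_iff, Submodule.submoduleOf,
    Submodule.comap_subtype_eq_top]
  exact ⟨fun h m hm => h m hm.1 hm.2, fun h m hm hm' => h ⟨hm, hm'⟩⟩

end KoszulBasic

/-! ### The Koszul complex as a mapping cone, and its acyclicity for a regular sequence. -/

section KoszulSplit

variable {A : Type*} [CommRing A] {d : ℕ}

theorem Finset.exists_map_succEmb_or_insert (S : Finset (Fin (d + 1))) :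
    ∃ T : Finset (Fin d), S = T.map (Fin.succEmb d) ∨ S = insert 0 (T.map (Fin.succEmb d)) := by
  refine ⟨Finset.univ.filter fun i => i.succ ∈ S, ?_⟩
  by_cases h : (0 : Fin (d + 1)) ∈ S
  · right
    ext i
    refine Fin.cases ?_ (fun j => ?_) i <;> simp [h, Fin.succ_ne_zero]
  · left
    ext i
    refine Fin.cases ?_ (fun j => ?_) i <;> simp [h, Fin.succ_ne_zero]

theorem Finset.filter_map_succEmb_card (T : Finset (Fin d)) (i : Fin d) :
    ((T.map (Fin.succEmb d)).filter (· < i.succ)).card = (T.filter (· < i)).card := by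
  rw [Finset.filter_map, Finset.card_map]
  congr 1
  ext j
  rw [Finset.mem_filter, Finset.mem_filter]
  exact and_congr_right fun _ => Fin.succ_lt_succ_iff

theorem Finset.filter_insert_zero_map_succEmb_card (T : Finset (Fin d)) (i : Fin d) :
    ((insert 0 (T.map (Fin.succEmb d))).filter (· < i.succ)).card =
      (T.filter (· < i)).card + 1 := by
  rw [Finset.filter_insert, if_pos (Fin.succ_pos i), Finset.card_insert_of_notMem (by simp),
    Finset.filter_map_succEmb_card]

variable (x : Fin (d + 1) → A) {M : Type*} [AddCommGroup M] [Module A M]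

/-- Splitting a chain as `a + e₀ ∧ b`, with `a` and `b` free of `e₀`, turns the differential into `a
↦ ∂'a + x₀ b`, `b ↦ -∂'b`: the cone of multiplication by `x₀` on the complex of the other elements.
The next lemma is the second component. -/
theorem koszulDifferential_apply_map_succEmb (m : Finset (Fin (d + 1)) → M)
    (T : Finset (Fin d)) :
    koszulDifferential x M m (T.map (Fin.succEmb d)) =
      x 0 • m (insert 0 (T.map (Fin.succEmb d))) +
        koszulDifferential (fun i => x i.succ) M (fun T => m (T.map (Fin.succEmb d))) T := by
  rw [koszulDifferential_apply, koszulDifferential_apply, Fin.sum_univ_succ]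
  congr 1
  · simp
  · refine Finset.sum_congr rfl fun i _ => ?_
    rw [Finset.filter_map_succEmb_card, Finset.map_insert]
    simp

theorem koszulDifferential_apply_insert_zero (m : Finset (Fin (d + 1)) → M)
    (T : Finset (Fin d)) :
    koszulDifferential x M m (insert 0 (T.map (Fin.succEmb d))) =
      - koszulDifferential (fun i => x i.succ) M
          (fun T => m (insert 0 (T.map (Fin.succEmb d)))) T := by
  rw [koszulDifferential_apply, koszulDifferential_apply, Fin.sum_univ_succ,
    if_pos (Finset.mem_insert_self _ _), zero_add, ← Finset.sum_neg_distrib]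
  refine Finset.sum_congr rfl fun i _ => ?_
  rw [Finset.filter_insert_zero_map_succEmb_card, Finset.map_insert, Finset.insert_comm]
  split_ifs <;> simp_all [pow_succ, Fin.succ_ne_zero]

theorem exists_koszulChain_split {N : Type*} (a b : Finset (Fin d) → N) :
    ∃ m : Finset (Fin (d + 1)) → N, (∀ T, m (T.map (Fin.succEmb d)) = a T) ∧
      ∀ T, m (insert 0 (T.map (Fin.succEmb d))) = b T := by
  refine ⟨fun S => if 0 ∈ S then b (Finset.univ.filter fun i => i.succ ∈ S)
    else a (Finset.univ.filter fun i => i.succ ∈ S), fun T => ?_, fun T => ?_⟩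
  · dsimp only
    rw [if_neg (by simp)]
    congr 1
    ext i
    simp
  · dsimp only
    rw [if_pos (by simp)]
    congr 1
    ext i
    simp [Fin.succ_ne_zero]

end KoszulSplit

/-- The Koszul homology of a regular sequence vanishes in positive degrees. -/
theorem KoszulAcyclic.of_isWeaklyRegular {A : Type*} [CommRing A] {d : ℕ} (x : Fin d → A)
    (M : Type*) [AddCommGroup M] [Module A M]
    (h : RingTheory.Sequence.IsWeaklyRegular M (List.ofFn x)) {p : ℕ} (hp : p ≠ 0) :
    KoszulAcyclic x M p := by
  induction d generalizing M p with
  | zero => exact KoszulAcyclic.of_lt (Nat.pos_of_ne_zero hp)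
  | succ d ih =>
    rw [List.ofFn_succ, RingTheory.Sequence.isWeaklyRegular_cons_iff] at h
    obtain ⟨h0, h⟩ := h
    intro m hm hdm
    set q : M →ₗ[A] QuotSMulTop (x 0) M := Submodule.mkQ _ with hq
    have hqs : Function.Surjective q := Submodule.mkQ_surjective _
    set s := Fin.succEmb d
    set x' : Fin d → A := fun i => x i.succ with hx'
    set a : Finset (Fin d) → M := fun T => m (T.map s) with ha
    set b : Finset (Fin d) → M := fun T => m (insert 0 (T.map s)) with hb
    have hab : koszulDifferential x' M a = - (x 0 • b) := by
      funext T
      have := koszulDifferential_apply_map_succEmb x m T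
      rw [hdm] at this
      exact (neg_eq_of_add_eq_zero_right this.symm).symm
    have hac : a ∈ koszulChains A d M p := fun T hT => hm _ (by simpa using hT)
    have hzero : ∀ v : M, q (x 0 • v) = 0 := fun v =>
      (Submodule.Quotient.mk_eq_zero _).mpr (Submodule.smul_mem_pointwise_smul _ _ _ trivial)
    -- Modulo `x₀` the component `a` is a cycle, so it bounds there. Lifting the bounding chain to
    -- `c` gives `a - ∂'c = x₀ e`; cancelling `x₀` yields `∂'e = -b`, so the pair `(c, e)` bounds
    -- `(a, b)`.
    obtain ⟨c', hc', hc'a⟩ := ih x' (QuotSMulTop (x 0) M) h hp (q.compLeft _ a)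
      (compLeft_mem_koszulChains q hac) (by
        rw [koszulDifferential_compLeft, hab]
        funext T
        simp [hzero])
    obtain ⟨c, hc, rfl⟩ := exists_koszulChain_lift_of_surjective hqs hc'
    have he : ∀ T, ∃ e, a T - koszulDifferential x' M c T = x 0 • e := by
      intro T
      rw [koszulDifferential_compLeft] at hc'a
      have : q (a T - koszulDifferential x' M c T) = 0 := by
        rw [map_sub, sub_eq_zero]
        exact (congrFun hc'a T).symm
      rw [hq, Submodule.mkQ_apply, Submodule.Quotient.mk_eq_zero,
        Submodule.mem_smul_pointwise_iff_exists] at this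
      obtain ⟨e, -, he⟩ := this
      exact ⟨e, he.symm⟩
    choose e he using he
    have hbe : koszulDifferential x' M e = - b := by
      have h1 : x 0 • e = a - koszulDifferential x' M c := funext fun T => (he T).symm
      have h2 : koszulDifferential x' M (x 0 • e) = - (x 0 • b) := by
        rw [h1, map_sub, koszulDifferential_koszulDifferential, hab, sub_zero]
      funext T
      have h3 := congrFun h2 T
      rw [map_smul] at h3
      exact h0 (by simpa using h3)
    obtain ⟨n, hn1, hn2⟩ := exists_koszulChain_split c e
    refine exists_koszulChain_differential_eq x hm (c := n) ?_
    funext S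
    obtain ⟨T, rfl | rfl⟩ := Finset.exists_map_succEmb_or_insert S
    · rw [koszulDifferential_apply_map_succEmb, hn2, funext hn1, ← he T]
      exact sub_add_cancel _ _
    · rw [koszulDifferential_apply_insert_zero, funext hn2, ← hx', hbe]
      exact neg_neg _

/-! ### Null-homotopy, Koszul classes and `H₀`. -/

section Homotopy

variable {A : Type*} [CommRing A] {d : ℕ} (x : Fin d → A)
  {M : Type*} [AddCommGroup M] [Module A M]

/-- Multiplication by `x j` is null-homotopic on the Koszul complex. -/
theorem exists_koszulDifferential_eq_smul (j : Fin d) {m : Finset (Fin d) → M}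
    (hm : koszulDifferential x M m = 0) :
    ∃ c, koszulDifferential x M c = x j • m := by
  -- The witness is the exterior product `e_j ∧ m`. At `T ∌ j` only the term `i = j` survives; at `T
  -- ∋ j` the cycle relation at `T \ {j}` is used.
  refine ⟨fun T => if j ∈ T then (-1 : A) ^ (T.filter (· < j)).card • m (T.erase j) else 0, ?_⟩
  funext T
  rw [koszulDifferential_apply]
  by_cases hj : j ∈ T
  · have h := congrFun hm (T.erase j)
    rw [koszulDifferential_apply, ← Finset.add_sum_erase _ _ (Finset.mem_univ j)] at h
    have hT : (T.erase j).filter (· < j) = T.filter (· < j) := by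
      ext k
      simp only [Finset.mem_filter, Finset.mem_erase]
      exact ⟨fun h => ⟨h.1.2, h.2⟩, fun h => ⟨⟨h.2.ne, h.1⟩, h.2⟩⟩
    rw [if_neg (Finset.notMem_erase j T), Finset.insert_erase hj, hT] at h
    have h' := congrArg (fun v => (-1 : A) ^ (T.filter (· < j)).card • v) h
    simp only [smul_add, smul_smul, Pi.zero_apply, smul_zero] at h'
    rw [← mul_assoc, ← pow_add, ← two_mul, pow_mul, neg_one_sq, one_pow, one_mul] at h'
    rw [Pi.smul_apply, eq_neg_of_add_eq_zero_left h', Finset.smul_sum, ← Finset.sum_neg_distrib,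
      ← Finset.add_sum_erase _ _ (Finset.mem_univ j), if_pos hj, zero_add]
    refine Finset.sum_congr rfl fun i hi => ?_
    have hij : i ≠ j := Finset.ne_of_mem_erase hi
    by_cases hiT : i ∈ T
    · rw [if_pos hiT, if_pos (Finset.mem_erase.mpr ⟨hij, hiT⟩)]
      simp
    · rw [if_neg hiT, if_neg (fun h => hiT (Finset.mem_of_mem_erase h)),
        if_pos (Finset.mem_insert_of_mem hj), smul_smul, smul_smul, ← neg_smul,
        Finset.erase_insert_of_ne hij]
      congr 1
      rw [Finset.filter_insert, Finset.filter_erase]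
      rcases lt_or_gt_of_ne hij with h | h
      · rw [if_pos h, Finset.card_insert_of_notMem (by simp [hiT]),
          Finset.erase_eq_of_notMem (by simp [h.le])]
        ring
      · rw [if_neg h.not_gt]
        have : j ∈ T.filter (· < i) := Finset.mem_filter.mpr ⟨hj, h⟩
        rw [← Finset.card_erase_add_one this]
        ring
  · rw [Finset.sum_eq_single j, if_neg hj, if_pos (Finset.mem_insert_self j T),
      Finset.erase_insert hj, smul_smul, Finset.filter_insert, if_neg (lt_irrefl j),
      mul_right_comm, ← pow_add, ← two_mul, pow_mul, neg_one_sq, one_pow, one_mul]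
    · rfl
    · intro i _ hij
      split_ifs with h1 h2
      · rfl
      · exact absurd ((Finset.mem_insert.mp h2).resolve_left hij.symm) hj
      · exact smul_zero _
    · exact fun h => absurd (Finset.mem_univ j) h

end Homotopy

section KoszulClass

variable {A : Type*} [CommRing A] {d : ℕ} (x : Fin d → A)
  (M : Type*) [AddCommGroup M] [Module A M]

/-- The class of a Koszul cycle in the Koszul homology. -/
def koszulClass (p : ℕ) : koszulCycles x M p →ₗ[A] KoszulHomology x M p :=
  Submodule.mkQ _

variable {x M} in
theorem mem_koszulCycles_iff {p : ℕ} {m : Finset (Fin d) → M} :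
    m ∈ koszulCycles x M p ↔ m ∈ koszulChains A d M p ∧ koszulDifferential x M m = 0 :=
  Iff.rfl

theorem koszulClass_surjective (p : ℕ) : Function.Surjective (koszulClass x M p) :=
  Submodule.mkQ_surjective _

variable {M} in
theorem koszulClass_eq_zero_iff {p : ℕ} (m : koszulCycles x M p) :
    koszulClass x M p m = 0 ↔
      ∃ c ∈ koszulChains A d M (p + 1), koszulDifferential x M c = m := by
  rw [koszulClass, Submodule.mkQ_apply, Submodule.Quotient.mk_eq_zero]
  rfl

/-- This translates between submodules `(x)M` and boundaries in degree zero, where a chain is its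
value at `∅`. -/
theorem mem_span_smul_top_iff_koszul (v : M) :
    v ∈ (Ideal.span (Set.range x) • ⊤ : Submodule A M) ↔
      ∃ c ∈ koszulChains A d M 1, koszulDifferential x M c ∅ = v := by
  classical
  constructor
  · intro hv
    induction hv using Submodule.smul_induction_on' with
    | smul a ha w _ =>
      obtain ⟨r, rfl⟩ := (Ideal.mem_span_range_iff_exists_fun).mp ha
      refine ⟨fun S => if S.card = 1 then ∑ i ∈ S, r i • w else 0, fun S hS => if_neg hS, ?_⟩
      rw [koszulDifferential_apply, Finset.sum_smul]
      refine Finset.sum_congr rfl fun i _ => ?_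
      simp [smul_smul, mul_comm]
    | add a _ b _ ha hb =>
      obtain ⟨c, hc, rfl⟩ := ha
      obtain ⟨c', hc', rfl⟩ := hb
      exact ⟨c + c', add_mem hc hc', by simp⟩
  · rintro ⟨c, -, rfl⟩
    rw [koszulDifferential_apply]
    refine Submodule.sum_mem _ fun i _ => ?_
    split_ifs
    · exact zero_mem _
    · exact Submodule.smul_mem_smul (Ideal.mul_mem_left _ _ (Ideal.subset_span ⟨i, rfl⟩)) trivial

variable {M} in
theorem koszulChains_zero_ext {m n : Finset (Fin d) → M} (hm : m ∈ koszulChains A d M 0)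
    (hn : n ∈ koszulChains A d M 0) (h : m ∅ = n ∅) : m = n := by
  funext S
  by_cases hS : S.card = 0
  · rw [Finset.card_eq_zero.mp hS, h]
  · rw [hm S hS, hn S hS]

variable {M} in
theorem single_empty_mem_koszulChains (v : M) :
    Pi.single ∅ v ∈ koszulChains A d M 0 := by
  intro S hS
  rw [Pi.single_eq_of_ne]
  exact fun h => hS (by simp [h])

end KoszulClass

section Comparison

variable {A : Type*} [CommRing A] {Z P Q : Type*} [AddCommGroup Z] [Module A Z]
  [AddCommGroup P] [Module A P] [AddCommGroup Q] [Module A Q]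

/-- A surjection `φ` and a map `ψ` that kills its kernel give a map with `f ∘ φ = ψ`. -/
theorem LinearMap.exists_comp_eq_of_surjective (φ : Z →ₗ[A] P) (ψ : Z →ₗ[A] Q)
    (hφ : Function.Surjective φ) (h : ∀ z, φ z = 0 → ψ z = 0) :
    ∃ f : P →ₗ[A] Q, ∀ z, f (φ z) = ψ z := by
  refine ⟨((LinearMap.ker φ).liftQ ψ fun z hz => h z hz) ∘ₗ
    (φ.quotKerEquivOfSurjective hφ).symm.toLinearMap, fun z => ?_⟩
  have : (φ.quotKerEquivOfSurjective hφ).symm (φ z) = Submodule.Quotient.mk z := by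
    rw [LinearEquiv.symm_apply_eq]
    rfl
  rw [LinearMap.comp_apply, LinearEquiv.coe_coe, this]
  rfl

end Comparison

section KoszulZero

variable {A : Type*} [CommRing A] {d : ℕ} (x : Fin d → A)
  (M : Type*) [AddCommGroup M] [Module A M]

/-- `H₀(x; M) = M / (x) M`. -/
theorem exists_koszulHomology_zero_equiv :
    ∃ e : KoszulHomology x M 0 ≃ₗ[A]
        (M ⧸ (Ideal.span (Set.range x) • ⊤ : Submodule A M)),
      ∀ m : koszulCycles x M 0, e (koszulClass x M 0 m) = Submodule.Quotient.mk (m.1 ∅) := by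
  set ψ : koszulCycles x M 0 →ₗ[A] (M ⧸ (Ideal.span (Set.range x) • ⊤ : Submodule A M)) :=
    Submodule.mkQ _ ∘ₗ LinearMap.proj ∅ ∘ₗ Submodule.subtype _ with hψ
  have hψa : ∀ m : koszulCycles x M 0, ψ m = Submodule.Quotient.mk (m.1 ∅) := fun _ => rfl
  have key : ∀ m, koszulClass x M 0 m = 0 ↔ ψ m = 0 := by
    intro m
    rw [koszulClass_eq_zero_iff, hψa, Submodule.Quotient.mk_eq_zero, mem_span_smul_top_iff_koszul]
    refine exists_congr fun c => and_congr_right fun hc => ⟨fun h => by rw [h], fun h => ?_⟩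
    exact koszulChains_zero_ext (koszulDifferential_mem_koszulChains x hc) m.2.1 h
  obtain ⟨f, hf⟩ := LinearMap.exists_comp_eq_of_surjective _ ψ (koszulClass_surjective x M 0)
    fun m => (key m).mp
  refine ⟨LinearEquiv.ofBijective f ⟨?_, fun v => ?_⟩, hf⟩
  · rw [← LinearMap.ker_eq_bot, LinearMap.ker_eq_bot']
    intro v hv
    obtain ⟨m, rfl⟩ := koszulClass_surjective x M 0 v
    exact (key m).mpr ((hf m).symm.trans hv)
  · obtain ⟨w, rfl⟩ := Submodule.Quotient.mk_surjective _ v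
    refine ⟨koszulClass x M 0 ⟨Pi.single ∅ w, single_empty_mem_koszulChains w,
      koszulDifferential_eq_zero_of_mem_koszulChains_zero x (single_empty_mem_koszulChains w)⟩, ?_⟩
    rw [hf, hψa]
    simp

end KoszulZero

/-! ### Koszul homology along `0 → W → S → S → R → 0`. -/

section Splice

variable {A : Type*} [CommRing A] {d : ℕ} (x : Fin d → A) (l : A)
  {S R W : Type*} [AddCommGroup S] [Module A S] [AddCommGroup R] [Module A R]
  [AddCommGroup W] [Module A W] (π : S →ₗ[A] R) (ι : W →ₗ[A] S)

/-- The triples that connect the cycles of degree `i + 2` of `R` with the cycles of degree `i` of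
`W`, for an exact sequence `0 → W → S → S → R → 0` whose middle map is multiplication by `l`. -/
def koszulSplice (i : ℕ) :
    Submodule A ((Finset (Fin d) → S) × (Finset (Fin d) → S) × (Finset (Fin d) → W)) where
  carrier := {z | z.1 ∈ koszulChains A d S (i + 2) ∧ z.2.1 ∈ koszulChains A d S (i + 1) ∧
    z.2.2 ∈ koszulChains A d W i ∧ koszulDifferential x S z.1 = l • z.2.1 ∧
    koszulDifferential x S z.2.1 = ι.compLeft _ z.2.2}
  add_mem' := by
    rintro z z' ⟨h1, h2, h3, h4, h5⟩ ⟨h1', h2', h3', h4', h5'⟩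
    refine ⟨add_mem h1 h1', add_mem h2 h2', add_mem h3 h3', ?_, ?_⟩
    · simp [h4, h4']
    · simp [h5, h5']
  zero_mem' := ⟨zero_mem _, zero_mem _, zero_mem _, by simp, by simp⟩
  smul_mem' := by
    rintro a z ⟨h1, h2, h3, h4, h5⟩
    refine ⟨Submodule.smul_mem _ a h1, Submodule.smul_mem _ a h2, Submodule.smul_mem _ a h3, ?_, ?_⟩
    · simp [h4, smul_comm a l]
    · simp [h5]

variable {l π ι}

theorem smul_eq_lsmul_compLeft (m : Finset (Fin d) → S) :
    l • m = (LinearMap.lsmul A S l).compLeft _ m := rfl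

theorem compLeft_smul_eq_zero (hlπ : Function.Exact (LinearMap.lsmul A S l) π)
    (m : Finset (Fin d) → S) : π.compLeft _ (l • m) = 0 :=
  funext fun T => (hlπ (l • m T)).mpr ⟨m T, rfl⟩

theorem smul_compLeft_eq_zero (hιl : Function.Exact ι (LinearMap.lsmul A S l))
    (m : Finset (Fin d) → W) : l • ι.compLeft _ m = 0 :=
  funext fun T => (hιl (ι (m T))).mpr ⟨m T, rfl⟩

/-- For a triple `(u, v, w)` with `∂u = l v` and `∂v = ι w`, `φ` takes the class of `π u` and `ψ`
that of `w`. As `φ` is onto and the kernels agree, `ψ ∘ φ⁻¹` is a well-defined injection, the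
composite of two connecting maps. Its image consists of the classes that become boundaries in `S`:
all of them when `i ≠ 0`, but a genuine condition when `i = 0`. -/
theorem exists_koszulSplice_maps (hι : Function.Injective ι)
    (hιl : Function.Exact ι (LinearMap.lsmul A S l))
    (hlπ : Function.Exact (LinearMap.lsmul A S l) π)
    (hπ : Function.Surjective π) (hS : ∀ p, p ≠ 0 → KoszulAcyclic x S p)
    (i : ℕ) :
    ∃ (φ : koszulSplice x l ι i →ₗ[A] KoszulHomology x R (i + 2))
      (ψ : koszulSplice x l ι i →ₗ[A] KoszulHomology x W i),
      Function.Surjective φ ∧ (∀ z, φ z = 0 ↔ ψ z = 0) ∧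
      (∀ w : koszulCycles x W i, koszulClass x W i w ∈ LinearMap.range ψ ↔
        ∃ c ∈ koszulChains A d S (i + 1), koszulDifferential x S c = ι.compLeft _ w.1) := by
  have h1 : ∀ z : koszulSplice x l ι i, π.compLeft _ z.1.1 ∈ koszulCycles x R (i + 2) := by
    rintro ⟨⟨u, v, w⟩, hu, hv, hw, huv, hvw⟩
    refine mem_koszulCycles_iff.mpr ⟨compLeft_mem_koszulChains _ hu, ?_⟩
    dsimp only at huv ⊢
    rw [koszulDifferential_compLeft, huv, compLeft_smul_eq_zero hlπ]
  have h2 : ∀ z : koszulSplice x l ι i, z.1.2.2 ∈ koszulCycles x W i := by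
    rintro ⟨⟨u, v, w⟩, hu, hv, hw, huv, hvw⟩
    refine ⟨hw, compLeft_injective hι ?_⟩
    dsimp only at hvw
    rw [← koszulDifferential_compLeft, ← hvw, koszulDifferential_koszulDifferential, map_zero]
  refine ⟨koszulClass x R (i + 2) ∘ₗ LinearMap.codRestrict _
      (π.compLeft _ ∘ₗ LinearMap.fst A _ _ ∘ₗ Submodule.subtype _) h1,
    koszulClass x W i ∘ₗ LinearMap.codRestrict _
      (LinearMap.snd A _ _ ∘ₗ LinearMap.snd A _ _ ∘ₗ Submodule.subtype _) h2, ?_, ?_, ?_⟩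
  · intro v
    obtain ⟨⟨r, hr, hdr⟩, rfl⟩ := koszulClass_surjective x R (i + 2) v
    obtain ⟨u, hu, rfl⟩ := exists_koszulChain_lift_of_surjective hπ hr
    replace hdr := (mem_koszulCycles_iff.mp ⟨hr, hdr⟩).2
    rw [koszulDifferential_compLeft] at hdr
    obtain ⟨v, hv, hvu⟩ := exists_koszulChain_lift_of_exact hlπ
      (koszulDifferential_mem_koszulChains x hu) hdr
    obtain ⟨w, hw, hwv⟩ := exists_koszulChain_lift_of_exact hιl
      (koszulDifferential_mem_koszulChains x hv) (by
        rw [← koszulDifferential_compLeft, hvu, koszulDifferential_koszulDifferential])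
    exact ⟨⟨⟨u, v, w⟩, hu, hv, hw, hvu.symm, hwv.symm⟩, rfl⟩
  · rintro ⟨⟨u, v, w⟩, hu, hv, hw, huv, hvw⟩
    rw [LinearMap.comp_apply, LinearMap.comp_apply, koszulClass_eq_zero_iff,
      koszulClass_eq_zero_iff]
    dsimp only at hu hv hw huv hvw
    change (∃ c ∈ _, _ = π.compLeft _ u) ↔ ∃ c ∈ _, _ = w
    constructor
    · rintro ⟨c, hc, hcu⟩
      obtain ⟨a, ha, rfl⟩ := exists_koszulChain_lift_of_surjective hπ hc
      rw [koszulDifferential_compLeft] at hcu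
      obtain ⟨b, hb, hbu⟩ := exists_koszulChain_lift_of_exact hlπ
        (sub_mem hu (koszulDifferential_mem_koszulChains x ha)) (by rw [map_sub, hcu, sub_self])
      rw [← smul_eq_lsmul_compLeft] at hbu
      have h3 : l • koszulDifferential x S b = l • v := by
        rw [← map_smul, hbu, map_sub, koszulDifferential_koszulDifferential, sub_zero, huv]
      obtain ⟨c', hc', hcv⟩ := exists_koszulChain_lift_of_exact hιl
        (sub_mem hv (koszulDifferential_mem_koszulChains x hb)) (by
          rw [← smul_eq_lsmul_compLeft, smul_sub, h3, sub_self])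
      refine ⟨c', hc', compLeft_injective hι ?_⟩
      rw [← koszulDifferential_compLeft, hcv, map_sub, koszulDifferential_koszulDifferential,
        sub_zero, hvw]
    · rintro ⟨c, hc, rfl⟩
      rw [← koszulDifferential_compLeft] at hvw
      -- Acyclicity of `S` is used twice: `v - ι c = ∂b`, and then `u - l b` is a cycle, hence a
      -- boundary. Applying `π` removes `l b`.
      obtain ⟨b, hb, hbv⟩ := hS (i + 1) (by omega) (v - ι.compLeft _ c)
        (sub_mem hv (compLeft_mem_koszulChains _ hc)) (by rw [map_sub, hvw, sub_self])
      obtain ⟨a, ha, hau⟩ := hS (i + 2) (by omega) (u - l • b)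
        (sub_mem hu (Submodule.smul_mem _ _ hb)) (by
          rw [map_sub, map_smul, hbv, huv, smul_sub, smul_compLeft_eq_zero hιl, sub_zero, sub_self])
      refine ⟨π.compLeft _ a, compLeft_mem_koszulChains _ ha, ?_⟩
      rw [koszulDifferential_compLeft, hau, map_sub, compLeft_smul_eq_zero hlπ, sub_zero]
  · rintro ⟨w, hw⟩
    constructor
    · rintro ⟨⟨⟨u, v, w'⟩, hu, hv, hw', huv, hvw⟩, h⟩
      dsimp only at hu hv hw' huv hvw
      have h' : koszulClass x W i (⟨w', h2 ⟨⟨u, v, w'⟩, hu, hv, hw', huv, hvw⟩⟩ - ⟨w, hw⟩) = 0 := by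
        rw [map_sub, sub_eq_zero]
        exact h
      rw [koszulClass_eq_zero_iff] at h'
      obtain ⟨c, hc, hcw⟩ := h'
      change _ = w' - w at hcw
      refine ⟨v - ι.compLeft _ c, sub_mem hv (compLeft_mem_koszulChains _ hc), ?_⟩
      rw [map_sub, hvw, koszulDifferential_compLeft, hcw, map_sub, sub_sub_cancel]
    · rintro ⟨v, hv, hvw⟩
      obtain ⟨u, hu, huv⟩ := hS (i + 1) (by omega) (l • v) (Submodule.smul_mem _ _ hv) (by
        rw [map_smul, hvw, smul_compLeft_eq_zero hιl])
      exact ⟨⟨⟨u, v, w⟩, hu, hv, hw.1, huv, hvw⟩, rfl⟩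

theorem exists_koszulHomology_injection (hι : Function.Injective ι)
    (hιl : Function.Exact ι (LinearMap.lsmul A S l))
    (hlπ : Function.Exact (LinearMap.lsmul A S l) π)
    (hπ : Function.Surjective π) (hS : ∀ p, p ≠ 0 → KoszulAcyclic x S p)
    (i : ℕ) :
    ∃ f : KoszulHomology x R (i + 2) →ₗ[A] KoszulHomology x W i, Function.Injective f ∧
      (∀ w : koszulCycles x W i, koszulClass x W i w ∈ LinearMap.range f ↔
        ∃ c ∈ koszulChains A d S (i + 1), koszulDifferential x S c = ι.compLeft _ w.1) := by
  obtain ⟨φ, ψ, hφ, hφψ, hψ⟩ := exists_koszulSplice_maps x hι hιl hlπ hπ hS i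
  obtain ⟨f, hf⟩ := LinearMap.exists_comp_eq_of_surjective φ ψ hφ fun z => (hφψ z).mp
  refine ⟨f, ?_, fun w => ?_⟩
  · rw [← LinearMap.ker_eq_bot, LinearMap.ker_eq_bot']
    intro v hv
    obtain ⟨z, rfl⟩ := hφ v
    exact (hφψ z).mpr ((hf z).symm.trans hv)
  · rw [← hψ w]
    constructor
    · rintro ⟨v, hv⟩
      obtain ⟨z, rfl⟩ := hφ v
      exact ⟨z, (hf z).symm.trans hv⟩
    · rintro ⟨z, hz⟩
      exact ⟨φ z, (hf z).trans hz⟩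

/-- `H_{i+2}(x; R) ≅ H_i(x; W)` in positive degrees. -/
theorem nonempty_koszulHomology_equiv (hι : Function.Injective ι)
    (hιl : Function.Exact ι (LinearMap.lsmul A S l))
    (hlπ : Function.Exact (LinearMap.lsmul A S l) π)
    (hπ : Function.Surjective π) (hS : ∀ p, p ≠ 0 → KoszulAcyclic x S p)
    (i : ℕ) (hi : i ≠ 0) :
    Nonempty (KoszulHomology x R (i + 2) ≃ₗ[A] KoszulHomology x W i) := by
  obtain ⟨f, hf, hr⟩ := exists_koszulHomology_injection x hι hιl hlπ hπ hS i
  refine ⟨LinearEquiv.ofBijective f ⟨hf, fun v => ?_⟩⟩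
  obtain ⟨w, rfl⟩ := koszulClass_surjective x W i v
  refine (hr w).mpr (hS i hi _ (compLeft_mem_koszulChains _ w.2.1) ?_)
  rw [koszulDifferential_compLeft, w.2.2, map_zero]

/-- The four-term exact sequence of the low degree Koszul homology. -/
theorem exists_koszul_four_term_exact (hι : Function.Injective ι)
    (hιl : Function.Exact ι (LinearMap.lsmul A S l))
    (hlπ : Function.Exact (LinearMap.lsmul A S l) π)
    (hπ : Function.Surjective π) (hS : ∀ p, p ≠ 0 → KoszulAcyclic x S p)
    :
    ∃ (f : KoszulHomology x R 2 →ₗ[A] (W ⧸ (Ideal.span (Set.range x) • ⊤ : Submodule A W)))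
      (g : (W ⧸ (Ideal.span (Set.range x) • ⊤ : Submodule A W)) →ₗ[A]
        LinearMap.ker
          (LinearMap.lsmul A (S ⧸ (Ideal.span (Set.range x) • ⊤ : Submodule A S)) l))
      (h : LinearMap.ker
          (LinearMap.lsmul A (S ⧸ (Ideal.span (Set.range x) • ⊤ : Submodule A S)) l) →ₗ[A]
        KoszulHomology x R 1),
      Function.Injective f ∧ Function.Exact f g ∧ Function.Exact g h ∧ Function.Surjective h ∧
      ∀ w : W, (g (Submodule.Quotient.mk w)).1 = Submodule.Quotient.mk (ι w) := by
  set X := Ideal.span (Set.range x) with hX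
  set K := LinearMap.ker (LinearMap.lsmul A (S ⧸ (X • ⊤ : Submodule A S)) l) with hK
  obtain ⟨f₀, hf₀, hr⟩ := exists_koszulHomology_injection x hι hιl hlπ hπ hS 0
  obtain ⟨e, he⟩ := exists_koszulHomology_zero_equiv x W
  have hWS : (X • ⊤ : Submodule A W) ≤ (X • ⊤ : Submodule A S).comap ι :=
    Submodule.smul_top_le_comap_smul_top X ι
  have hlι : ∀ w, l • ι w = 0 := fun w => (hιl (ι w)).mpr ⟨w, rfl⟩
  set g : (W ⧸ (X • ⊤ : Submodule A W)) →ₗ[A] K :=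
    LinearMap.codRestrict K (Submodule.mapQ _ _ ι hWS) (by
      intro v
      obtain ⟨w, rfl⟩ := Submodule.Quotient.mk_surjective _ v
      rw [hK, LinearMap.mem_ker, LinearMap.lsmul_apply, Submodule.mapQ_apply,
        ← Submodule.Quotient.mk_smul, hlι, Submodule.Quotient.mk_zero]) with hg
  have hgw : ∀ w : W, (g (Submodule.Quotient.mk w)).1 = Submodule.Quotient.mk (ι w) :=
    fun _ => rfl
  -- the pairs `(s, u)` with `l s = ∂ u`
  set Y : Submodule A ((Finset (Fin d) → S) × (Finset (Fin d) → S)) :=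
    ((koszulChains A d S 0).prod (koszulChains A d S 1)) ⊓
      LinearMap.eqLocus (l • LinearMap.fst A _ _) (koszulDifferential x S ∘ₗ LinearMap.snd A _ _)
    with hY
  have hYm : ∀ {z}, z ∈ Y ↔ (z.1 ∈ koszulChains A d S 0 ∧ z.2 ∈ koszulChains A d S 1) ∧
      l • z.1 = koszulDifferential x S z.2 := Iff.rfl
  have hK' : ∀ z : Y, (Submodule.mkQ (X • ⊤ : Submodule A S)) (z.1.1 ∅) ∈ K := by
    rintro ⟨⟨s, u⟩, hz⟩
    obtain ⟨⟨hs, hu⟩, hsu⟩ := hYm.mp hz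
    rw [hK, LinearMap.mem_ker, LinearMap.lsmul_apply, ← map_smul, Submodule.mkQ_apply,
      Submodule.Quotient.mk_eq_zero, hX, mem_span_smul_top_iff_koszul]
    exact ⟨u, hu, (congrFun hsu ∅).symm⟩
  have hR' : ∀ z : Y, π.compLeft _ z.1.2 ∈ koszulCycles x R 1 := by
    rintro ⟨⟨s, u⟩, hz⟩
    obtain ⟨⟨hs, hu⟩, hsu⟩ := hYm.mp hz
    refine mem_koszulCycles_iff.mpr ⟨compLeft_mem_koszulChains _ hu, ?_⟩
    dsimp only at hsu ⊢
    rw [koszulDifferential_compLeft, ← hsu, compLeft_smul_eq_zero hlπ]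
  set φ : Y →ₗ[A] K := LinearMap.codRestrict K (Submodule.mkQ _ ∘ₗ LinearMap.proj ∅ ∘ₗ
    LinearMap.fst A _ _ ∘ₗ Submodule.subtype _) hK' with hφ
  set ψ : Y →ₗ[A] KoszulHomology x R 1 := koszulClass x R 1 ∘ₗ LinearMap.codRestrict _
    (π.compLeft _ ∘ₗ LinearMap.snd A _ _ ∘ₗ Submodule.subtype _) hR' with hψ
  have hφs : Function.Surjective φ := by
    rintro ⟨v, hv⟩
    obtain ⟨s, rfl⟩ := Submodule.Quotient.mk_surjective _ v
    rw [hK, LinearMap.mem_ker, LinearMap.lsmul_apply, ← Submodule.Quotient.mk_smul,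
      Submodule.Quotient.mk_eq_zero, hX, mem_span_smul_top_iff_koszul] at hv
    obtain ⟨u, hu, hus⟩ := hv
    refine ⟨⟨⟨Pi.single ∅ s, u⟩, hYm.mpr ⟨⟨single_empty_mem_koszulChains s, hu⟩, ?_⟩⟩, ?_⟩
    · refine koszulChains_zero_ext (A := A) (Submodule.smul_mem _ _ (single_empty_mem_koszulChains s))
        (koszulDifferential_mem_koszulChains x hu) ?_
      rw [hus]
      simp
    · refine Subtype.ext ?_
      change Submodule.Quotient.mk ((Pi.single ∅ s : Finset (Fin d) → S) ∅) = _
      simp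
  have hψs : Function.Surjective ψ := by
    intro v
    obtain ⟨⟨r, hr, hdr⟩, rfl⟩ := koszulClass_surjective x R 1 v
    obtain ⟨u, hu, rfl⟩ := exists_koszulChain_lift_of_surjective hπ hr
    replace hdr := (mem_koszulCycles_iff.mp ⟨hr, hdr⟩).2
    rw [koszulDifferential_compLeft] at hdr
    obtain ⟨s, hs, hsu⟩ := exists_koszulChain_lift_of_exact hlπ
      (koszulDifferential_mem_koszulChains x hu) hdr
    exact ⟨⟨⟨s, u⟩, hYm.mpr ⟨⟨hs, hu⟩, hsu⟩⟩, rfl⟩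
  -- Since `ι W` is the kernel of `l`, the right side says that `s` lies in `ι W + (x)S`. This makes
  -- `h` well defined and identifies its kernel with the image of `g`.
  have hψ0 : ∀ (s u) (hz : (s, u) ∈ Y), ψ ⟨(s, u), hz⟩ = 0 ↔
      ∃ v ∈ koszulChains A d S 1, l • s = l • koszulDifferential x S v := by
    intro s u hz
    obtain ⟨⟨hs, hu⟩, hsu⟩ := hYm.mp hz
    dsimp only at hs hu hsu
    rw [hψ, LinearMap.comp_apply, koszulClass_eq_zero_iff]
    change (∃ c ∈ _, _ = π.compLeft _ u) ↔ _
    constructor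
    · rintro ⟨c, hc, hcu⟩
      obtain ⟨a, ha, rfl⟩ := exists_koszulChain_lift_of_surjective hπ hc
      rw [koszulDifferential_compLeft] at hcu
      obtain ⟨b, hb, hbu⟩ := exists_koszulChain_lift_of_exact hlπ
        (sub_mem hu (koszulDifferential_mem_koszulChains x ha)) (by rw [map_sub, hcu, sub_self])
      rw [← smul_eq_lsmul_compLeft] at hbu
      refine ⟨b, hb, ?_⟩
      rw [← map_smul, hbu, map_sub, koszulDifferential_koszulDifferential, sub_zero, hsu]
    · rintro ⟨v, hv, hsv⟩
      obtain ⟨a, ha, hau⟩ := hS 1 one_ne_zero (u - l • v)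
        (sub_mem hu (Submodule.smul_mem _ _ hv)) (by
          rw [map_sub, map_smul, ← hsv, hsu, sub_self])
      refine ⟨π.compLeft _ a, compLeft_mem_koszulChains _ ha, ?_⟩
      rw [koszulDifferential_compLeft, hau, map_sub, compLeft_smul_eq_zero hlπ, sub_zero]
  obtain ⟨h, hh⟩ := LinearMap.exists_comp_eq_of_surjective φ ψ hφs (by
    rintro ⟨⟨s, u⟩, hz⟩ h0
    have hs := (hYm.mp hz).1.1
    rw [hψ0]
    have h0' : Submodule.Quotient.mk (p := (X • ⊤ : Submodule A S)) (s ∅) = 0 :=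
      congrArg Subtype.val h0
    rw [Submodule.Quotient.mk_eq_zero, hX, mem_span_smul_top_iff_koszul] at h0'
    obtain ⟨v, hv, hvs⟩ := h0'
    refine ⟨v, hv, ?_⟩
    rw [koszulChains_zero_ext (koszulDifferential_mem_koszulChains x hv) hs hvs])
  refine ⟨e.toLinearMap ∘ₗ f₀, g, h, e.injective.comp hf₀, ?_, ?_, ?_, hgw⟩
  · intro v
    obtain ⟨w, rfl⟩ := Submodule.Quotient.mk_surjective _ v
    set w' : koszulCycles x W 0 := ⟨Pi.single ∅ w, single_empty_mem_koszulChains w,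
      koszulDifferential_eq_zero_of_mem_koszulChains_zero x (single_empty_mem_koszulChains w)⟩
      with hw'
    have hew : e (koszulClass x W 0 w') = Submodule.Quotient.mk w := by
      rw [he, hw']
      simp
    have h1 : Submodule.Quotient.mk w ∈ Set.range (e.toLinearMap ∘ₗ f₀) ↔
        koszulClass x W 0 w' ∈ LinearMap.range f₀ := by
      rw [← hew]
      constructor
      · rintro ⟨t, ht⟩
        exact ⟨t, e.injective ht⟩
      · rintro ⟨t, ht⟩
        exact ⟨t, congrArg e ht⟩
    rw [h1, hr, ← Subtype.coe_inj, hgw, ZeroMemClass.coe_zero, Submodule.Quotient.mk_eq_zero, hX,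
      mem_span_smul_top_iff_koszul]
    refine exists_congr fun c => and_congr_right fun hc => ⟨fun h => ?_, fun h => ?_⟩
    · refine koszulChains_zero_ext (koszulDifferential_mem_koszulChains x hc)
        (compLeft_mem_koszulChains _ (single_empty_mem_koszulChains w)) ?_
      rw [h]
      simp [hw']
    · rw [h]
      simp [hw']
  · intro v
    obtain ⟨⟨⟨s, u⟩, hz⟩, rfl⟩ := hφs v
    obtain ⟨⟨hs, hu⟩, hsu⟩ := hYm.mp hz
    rw [hh, hψ0]
    constructor
    · rintro ⟨b, hb, hbs⟩
      have h1 : LinearMap.lsmul A S l (s ∅ - koszulDifferential x S b ∅) = 0 := by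
        rw [map_sub, sub_eq_zero]
        exact congrFun hbs ∅
      obtain ⟨w, hw⟩ := (hιl _).mp h1
      refine ⟨Submodule.Quotient.mk w, Subtype.ext ?_⟩
      rw [hgw, hw]
      change _ = Submodule.Quotient.mk (s ∅)
      rw [Submodule.Quotient.eq, sub_sub_cancel_left, Submodule.neg_mem_iff, hX,
        mem_span_smul_top_iff_koszul]
      exact ⟨b, hb, rfl⟩
    · rintro ⟨w, hw⟩
      obtain ⟨w, rfl⟩ := Submodule.Quotient.mk_surjective _ w
      have hw' : Submodule.Quotient.mk (p := (X • ⊤ : Submodule A S)) (ι w) =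
        Submodule.Quotient.mk (s ∅) := congrArg Subtype.val hw
      rw [Submodule.Quotient.eq, ← Submodule.neg_mem_iff, neg_sub, hX,
        mem_span_smul_top_iff_koszul] at hw'
      obtain ⟨b, hb, hbs⟩ := hw'
      refine ⟨b, hb, ?_⟩
      refine koszulChains_zero_ext (A := A) (Submodule.smul_mem _ _ hs)
        (Submodule.smul_mem _ _ (koszulDifferential_mem_koszulChains x hb)) ?_
      rw [Pi.smul_apply, Pi.smul_apply, hbs, smul_sub, hlι, sub_zero]
  · intro v
    obtain ⟨z, rfl⟩ := hψs v
    exact ⟨φ z, hh z⟩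

end Splice

/-! ### Depth measured by Koszul homology. -/

section DepthSensitivity

open IsLocalRing RingTheory.Sequence

variable {A : Type*} [CommRing A] {d : ℕ} (x : Fin d → A)

theorem exists_koszulDifferential_eq_smul_of_mem {M : Type*} [AddCommGroup M] [Module A M]
    {a : A} (ha : a ∈ Ideal.span (Set.range x) ⊔ Module.annihilator A M)
    {m : Finset (Fin d) → M} (hm : koszulDifferential x M m = 0) :
    ∃ c, koszulDifferential x M c = a • m := by
  set I : Ideal A := (LinearMap.range (koszulDifferential x M)).comap
    (LinearMap.toSpanSingleton A _ m) with hI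
  suffices h : Ideal.span (Set.range x) ⊔ Module.annihilator A M ≤ I from h ha
  refine sup_le (Ideal.span_le.mpr ?_) fun b hb => ?_
  · rintro _ ⟨j, rfl⟩
    exact exists_koszulDifferential_eq_smul x j hm
  · refine ⟨0, ?_⟩
    rw [map_zero]
    funext S
    exact (Module.mem_annihilator.mp hb (m S)).symm

variable {x}

/-- In the long exact sequence of `0 → M → M → M/rM → 0` the hypothesis makes `r` injective on
`H_i(M)`, while a power of `r` annihilates `H_i(M)`. -/
theorem KoszulAcyclic.of_quotSMulTop_succ {M : Type*} [AddCommGroup M] [Module A M] {r : A}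
    (hr : IsSMulRegular M r)
    (hrad : r ∈ (Ideal.span (Set.range x) ⊔ Module.annihilator A M).radical) {i : ℕ}
    (h : KoszulAcyclic x (QuotSMulTop r M) (i + 1)) : KoszulAcyclic x M i := by
  -- Cancels one factor `r`: if `∂c = r z`, then `c` is a cycle modulo `r`, so `c = ∂u + r v` and
  -- `∂v = z`.
  have step : ∀ z ∈ koszulChains A d M i, koszulDifferential x M z = 0 →
      (∃ c, koszulDifferential x M c = r • z) → ∃ c, koszulDifferential x M c = z := by
    intro z hz hdz hc
    obtain ⟨c', hc'⟩ := hc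
    obtain ⟨c, hc, hcz⟩ := exists_koszulChain_differential_eq x (Submodule.smul_mem _ r hz) hc'
    set q : M →ₗ[A] QuotSMulTop r M := Submodule.mkQ _ with hq
    have hex : Function.Exact (LinearMap.lsmul A M r) q := LinearMap.exact_lsmul_mkQ_smul_top M r
    obtain ⟨e, he, hec⟩ := h (q.compLeft _ c) (compLeft_mem_koszulChains q hc) (by
      rw [koszulDifferential_compLeft, hcz, compLeft_smul_eq_zero hex])
    obtain ⟨u, hu, rfl⟩ := exists_koszulChain_lift_of_surjective (Submodule.mkQ_surjective _) he
    rw [koszulDifferential_compLeft] at hec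
    obtain ⟨v, hv, hvc⟩ := exists_koszulChain_lift_of_exact hex
      (sub_mem hc (koszulDifferential_mem_koszulChains x hu))
      (by rw [map_sub, sub_eq_zero]; exact hec.symm)
    refine ⟨v, ?_⟩
    have h1 : r • koszulDifferential x M v = r • z := by
      rw [← map_smul, smul_eq_lsmul_compLeft, hvc, map_sub, koszulDifferential_koszulDifferential,
        sub_zero, hcz]
    exact funext fun T => hr (congrFun h1 T)
  intro z hz hdz
  obtain ⟨n, hn⟩ := hrad
  have hpow := exists_koszulDifferential_eq_smul_of_mem x hn hdz
  suffices h0 : ∃ c, koszulDifferential x M c = z by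
    obtain ⟨c, hc⟩ := h0
    exact exists_koszulChain_differential_eq x hz hc
  clear hn
  induction n with
  | zero => simpa using hpow
  | succ n ih =>
    refine ih (step _ (Submodule.smul_mem _ _ hz) (by rw [map_smul, hdz, smul_zero]) ?_)
    rwa [smul_smul, ← pow_succ']

/-- This is exactness of `H_i(M) → H_i(M/rM) → H_{i-1}(M)`, where the last term is absent for `i =
0`. -/
theorem KoszulAcyclic.quotSMulTop {M : Type*} [AddCommGroup M] [Module A M] {r : A}
    (hr : IsSMulRegular M r) {i : ℕ} (h : KoszulAcyclic x M i)
    (h' : ∀ j, i = j + 1 → KoszulAcyclic x M j) : KoszulAcyclic x (QuotSMulTop r M) i := by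
  set q : M →ₗ[A] QuotSMulTop r M := Submodule.mkQ _ with hq
  have hex : Function.Exact (LinearMap.lsmul A M r) q := LinearMap.exact_lsmul_mkQ_smul_top M r
  intro z hz hdz
  obtain ⟨m, hm, rfl⟩ := exists_koszulChain_lift_of_surjective (Submodule.mkQ_surjective _) hz
  change koszulDifferential x _ (q.compLeft _ m) = 0 at hdz
  suffices hc : ∃ c, koszulDifferential x M (m - r • c) = 0 ∧ c ∈ koszulChains A d M i by
    obtain ⟨c, hc, hci⟩ := hc
    obtain ⟨e, he, hem⟩ := h _ (sub_mem hm (Submodule.smul_mem _ _ hci)) hc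
    refine ⟨q.compLeft _ e, compLeft_mem_koszulChains _ he, ?_⟩
    rw [koszulDifferential_compLeft, hem, map_sub, compLeft_smul_eq_zero hex, sub_zero]
  rcases i with _ | i
  · exact ⟨0, by simpa using koszulDifferential_eq_zero_of_mem_koszulChains_zero x hm, zero_mem _⟩
  · rw [koszulDifferential_compLeft] at hdz
    obtain ⟨n, hn, hnm⟩ := exists_koszulChain_lift_of_exact hex
      (koszulDifferential_mem_koszulChains x hm) hdz
    rw [← smul_eq_lsmul_compLeft] at hnm
    have hdn : koszulDifferential x M n = 0 := by
      have h1 : r • koszulDifferential x M n = 0 := by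
        rw [← map_smul, hnm, koszulDifferential_koszulDifferential]
      exact funext fun T => hr ((congrFun h1 T).trans (smul_zero r).symm)
    obtain ⟨c, hc, hcn⟩ := h' i rfl n hn hdn
    exact ⟨c, by rw [map_sub, map_smul, hcn, hnm, sub_self], hc⟩

theorem Module.annihilator_le_annihilator_quotSMulTop (M : Type*) [AddCommGroup M] [Module A M]
    (r : A) : Module.annihilator A M ≤ Module.annihilator A (QuotSMulTop r M) :=
  LinearMap.annihilator_le_of_surjective (Submodule.mkQ _) (Submodule.mkQ_surjective _)

theorem KoszulAcyclic.of_isWeaklyRegular_of_radical {M : Type*} [AddCommGroup M] [Module A M]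
    {rs : List A}
    (hrs : ∀ r ∈ rs, r ∈ (Ideal.span (Set.range x) ⊔ Module.annihilator A M).radical)
    (h : IsWeaklyRegular M rs) {i : ℕ} (hi : d < i + rs.length) : KoszulAcyclic x M i := by
  induction rs generalizing M i with
  | nil => exact KoszulAcyclic.of_lt (by simpa using hi)
  | cons r rs ih =>
    rw [isWeaklyRegular_cons_iff] at h
    refine KoszulAcyclic.of_quotSMulTop_succ h.1 (hrs r List.mem_cons_self)
      (ih (fun s hs => ?_) h.2 (by simp at hi; omega))
    exact Ideal.radical_mono (sup_le_sup_left
      (Module.annihilator_le_annihilator_quotSMulTop M r) _) (hrs s (List.mem_cons_of_mem r hs))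

/-- `H_d(M)` is the set of elements killed by all `x_j`, so its vanishing forces `Hom(A/𝔪, M) = 0`
and yields an `M`-regular `r ∈ 𝔪`. Passing to `M/rM` costs one degree of vanishing. -/
theorem exists_isRegular_of_koszulAcyclic [IsLocalRing A] [IsNoetherianRing A]
    (M : Type*) [AddCommGroup M] [Module A M] [Module.Finite A M] [Nontrivial M]
    (hx : ∀ j, x j ∈ maximalIdeal A) {k : ℕ} (h : ∀ i, d < i + k → KoszulAcyclic x M i) :
    ∃ rs : List A, (∀ r ∈ rs, r ∈ maximalIdeal A) ∧ IsRegular M rs ∧ rs.length = k := by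
  induction k generalizing M with
  | zero => exact ⟨[], by simp, IsRegular.nil A M, rfl⟩
  | succ k ih =>
    have hsub : Subsingleton ((A ⧸ maximalIdeal A) →ₗ[A] M) := by
      refine subsingleton_of_forall_eq 0 fun f => ?_
      have hv : ∀ a ∈ maximalIdeal A, a • f 1 = 0 := by
        intro a ha
        have h1 : a • (1 : A ⧸ maximalIdeal A) = Ideal.Quotient.mk _ a := by
          rw [Algebra.smul_def, mul_one]
          rfl
        rw [← map_smul, h1, Ideal.Quotient.eq_zero_iff_mem.mpr ha, map_zero]
      have hv0 : f 1 = 0 := by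
        obtain ⟨c, hc, hcv⟩ := h d (by omega) (Pi.single Finset.univ (f 1)) (fun S hS => by
            rw [Pi.single_eq_of_ne]
            rintro rfl
            simp at hS) (by
          funext T
          refine Finset.sum_eq_zero fun i _ => ?_
          by_cases hT : insert i T = Finset.univ
          · rw [hT, Pi.single_eq_same]
            exact hv _ (Ideal.mul_mem_left _ _ (hx i))
          · rw [Pi.single_eq_of_ne hT, smul_zero])
        rw [eq_zero_of_mem_koszulChains_of_lt d.lt_succ_self hc, map_zero] at hcv
        simpa using (congrFun hcv Finset.univ).symm
      refine LinearMap.ext fun t => ?_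
      obtain ⟨a, rfl⟩ := Ideal.Quotient.mk_surjective t
      have h1 : Ideal.Quotient.mk (maximalIdeal A) a = a • (1 : A ⧸ maximalIdeal A) := by
        rw [Algebra.smul_def, mul_one]
        rfl
      rw [h1, map_smul, hv0, smul_zero, LinearMap.zero_apply]
    obtain ⟨r, hr, hreg⟩ := IsSMulRegular.subsingleton_linearMap_iff.mp hsub
    rw [Ideal.annihilator_quotient] at hr
    have := nontrivial_quotSMulTop_of_mem_maximalIdeal M hr
    obtain ⟨rs, hrs, hrr, hl⟩ := ih (QuotSMulTop r M) fun i hi =>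
      KoszulAcyclic.quotSMulTop hreg (h i (by omega)) fun j hj => h j (by omega)
    refine ⟨r :: rs, ?_, IsRegular.cons hreg hrr, by simp [hl]⟩
    intro s hs
    rcases List.mem_cons.mp hs with rfl | hs
    exacts [hr, hrs s hs]

theorem natCast_le_moduleDepth_iff_exists [IsLocalRing A]
    (M : Type*) [AddCommGroup M] [Module A M] [Nontrivial M] {k : ℕ} :
    (k : ℕ∞) ≤ moduleDepth A M ↔ ∃ rs : List A, (∀ r ∈ rs, r ∈ maximalIdeal A) ∧
      IsRegular M rs ∧ k ≤ rs.length := by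
  constructor
  · intro h
    rcases k with _ | k
    · exact ⟨[], by simp, IsRegular.nil A M, le_rfl⟩
    · have h' : (k : ℕ∞) < moduleDepth A M :=
        lt_of_lt_of_le (by exact_mod_cast k.lt_succ_self) h
      obtain ⟨⟨rs, h1, h2⟩, h3⟩ := lt_iSup_iff.mp h'
      exact ⟨rs, h1, h2, by exact_mod_cast h3⟩
  · rintro ⟨rs, h1, h2, h3⟩
    exact le_trans (by exact_mod_cast h3)
      (le_iSup (fun rs : {rs : List A // (∀ r ∈ rs, r ∈ maximalIdeal A) ∧ IsRegular M rs} =>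
        (rs.1.length : ℕ∞)) ⟨rs, h1, h2⟩)

/-- The depth of `M` is detected by the Koszul homology of a sequence that generates an
`M`-primary ideal. -/
theorem natCast_le_moduleDepth_iff_koszulAcyclic [IsLocalRing A] [IsNoetherianRing A]
    (M : Type*) [AddCommGroup M] [Module A M] [Module.Finite A M] [Nontrivial M]
    (hx : ∀ j, x j ∈ maximalIdeal A)
    (hrad : maximalIdeal A ≤ (Ideal.span (Set.range x) ⊔ Module.annihilator A M).radical) (k : ℕ) :
    (k : ℕ∞) ≤ moduleDepth A M ↔ ∀ i, d < i + k → KoszulAcyclic x M i := by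
  rw [natCast_le_moduleDepth_iff_exists]
  constructor
  · rintro ⟨rs, h1, h2, h3⟩ i hi
    exact KoszulAcyclic.of_isWeaklyRegular_of_radical (fun r hr => hrad (h1 r hr))
      h2.toIsWeaklyRegular (by omega)
  · intro h
    obtain ⟨rs, h1, h2, h3⟩ := exists_isRegular_of_koszulAcyclic M hx h
    exact ⟨rs, h1, h2, h3.ge⟩

theorem not_koszulAcyclic_zero [IsLocalRing A]
    (M : Type*) [AddCommGroup M] [Module A M] [Module.Finite A M] [Nontrivial M]
    (hx : ∀ j, x j ∈ maximalIdeal A) : ¬ KoszulAcyclic x M 0 := by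
  rw [koszulAcyclic_iff_subsingleton, (exists_koszulHomology_zero_equiv x M).choose.subsingleton_congr,
    Submodule.Quotient.subsingleton_iff]
  refine (Submodule.top_ne_ideal_smul_of_le_jacobson_annihilator
    (le_trans (Ideal.span_le.mpr ?_) (maximalIdeal_le_jacobson _))).symm
  rintro _ ⟨j, rfl⟩
  exact hx j

end DepthSensitivity

/-! ### Associated primes, systems of parameters and height. -/

section CohenMacaulay

open IsLocalRing RingTheory.Sequence
open scoped Pointwise

variable {A : Type*} [CommRing A]

theorem mem_minimalPrimes_of_le_radical [IsLocalRing A] {I : Ideal A} (hI : I ≤ maximalIdeal A)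
    (h : maximalIdeal A ≤ I.radical) : maximalIdeal A ∈ I.minimalPrimes := by
  refine ⟨⟨inferInstance, hI⟩, fun q hq _ => ?_⟩
  have := hq.1
  exact h.trans (this.radical_le_iff.mpr hq.2)

theorem ringKrullDim_le_length_of_le_radical [IsLocalRing A] [IsNoetherianRing A] {us : List A}
    (hus : ∀ u ∈ us, u ∈ maximalIdeal A) (h : maximalIdeal A ≤ (Ideal.ofList us).radical) :
    ringKrullDim A ≤ us.length := by
  classical
  have h1 : maximalIdeal A ∈ (Ideal.span (us.toFinset : Set A)).minimalPrimes := by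
    have h2 : Ideal.span (us.toFinset : Set A) = Ideal.ofList us := by simp [Ideal.ofList]
    rw [h2]
    exact mem_minimalPrimes_of_le_radical (Ideal.span_le.mpr hus) h
  have h3 := Ideal.height_le_card_of_mem_minimalPrimes_span_finset h1
  rw [← maximalIdeal_height_eq_ringKrullDim]
  exact_mod_cast h3.trans (by exact_mod_cast us.toFinset_card_le)

theorem ringKrullDim_quotient_le_length [IsLocalRing A] [IsNoetherianRing A] {us : List A}
    (hus : ∀ u ∈ us, u ∈ maximalIdeal A) {p : Ideal A} (hp : p ≠ ⊤)
    (h : maximalIdeal A ≤ (Ideal.ofList us ⊔ p).radical) :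
    ringKrullDim (A ⧸ p) ≤ us.length := by
  have := Ideal.Quotient.nontrivial_iff.mpr hp
  have : IsLocalRing (A ⧸ p) :=
    IsLocalRing.of_surjective' (Ideal.Quotient.mk p) Ideal.Quotient.mk_surjective
  have hloc : IsLocalHom (Ideal.Quotient.mk p) :=
    IsLocalHom.of_surjective _ Ideal.Quotient.mk_surjective
  rw [← us.length_map (Ideal.Quotient.mk p)]
  refine ringKrullDim_le_length_of_le_radical ?_ ?_
  · intro u hu
    obtain ⟨v, hv, rfl⟩ := List.mem_map.mp hu
    exact (map_mem_nonunits_iff (Ideal.Quotient.mk p) v).mpr (hus v hv)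
  · intro b hb
    obtain ⟨a, rfl⟩ := Ideal.Quotient.mk_surjective b
    obtain ⟨n, hn⟩ := h ((map_mem_nonunits_iff (Ideal.Quotient.mk p) a).mp hb)
    refine ⟨n, ?_⟩
    have h1 := Ideal.mem_map_of_mem (Ideal.Quotient.mk p) hn
    rwa [Ideal.map_sup, Ideal.map_quotient_self, sup_bot_eq, Ideal.map_ofList, map_pow] at h1

/-- `N = (0 :_M p)` is nonzero and is not contained in `rM`: otherwise regularity of `r` gives `N =
rN`, and Nakayama gives `N = 0`. An element of `N` outside `rM` has nonzero image in `M/rM`, killed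
by `p` and by `r`. -/
theorem exists_associatedPrime_quotSMulTop [IsLocalRing A] [IsNoetherianRing A]
    {M : Type*} [AddCommGroup M] [Module A M] [Module.Finite A M] {p : Ideal A}
    (hp : p ∈ associatedPrimes A M) {r : A} (hr : r ∈ maximalIdeal A) (hreg : IsSMulRegular M r) :
    ∃ q ∈ associatedPrimes A (QuotSMulTop r M), p ≤ q ∧ r ∈ q := by
  obtain ⟨hpp, m, hm⟩ := isAssociatedPrime_iff.mp hp
  set N : Submodule A M :=
    { carrier := {n | ∀ a ∈ p, a • n = 0}
      add_mem' := fun h h' a ha => by rw [smul_add, h a ha, h' a ha, add_zero]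
      zero_mem' := fun a _ => smul_zero a
      smul_mem' := fun b n h a ha => by rw [smul_comm, h a ha, smul_zero] } with hN
  have hmN : m ∈ N := fun a ha => by
    rw [hm, Submodule.mem_colon_singleton] at ha
    exact ha
  have hm0 : m ≠ 0 := by
    rintro rfl
    exact hpp.ne_top (by rw [hm]; simp)
  have hNr : ¬ N ≤ r • (⊤ : Submodule A M) := by
    intro hle
    have h1 : N ≤ Ideal.span {r} • N := by
      intro n hn
      obtain ⟨v, -, rfl⟩ := Submodule.mem_smul_pointwise_iff_exists _ _ _ |>.mp (hle hn)
      refine Submodule.smul_mem_smul (Ideal.mem_span_singleton_self r) fun a ha => hreg ?_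
      change r • a • v = r • 0
      rw [smul_comm, hn a ha, smul_zero]
    have h2 := Submodule.eq_bot_of_le_smul_of_le_jacobson_bot (Ideal.span {r}) N
      (IsNoetherian.noetherian N) h1 (by
        rw [jacobson_eq_maximalIdeal ⊥ bot_ne_top]
        exact (Ideal.span_singleton_le_iff_mem _).mpr hr)
    rw [h2] at hmN
    exact hm0 hmN
  obtain ⟨n, hn, hnr⟩ := SetLike.not_le_iff_exists.mp hNr
  obtain ⟨q, hq, hqn⟩ := exists_le_isAssociatedPrime_of_isNoetherianRing A
    (Submodule.Quotient.mk n : QuotSMulTop r M)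
    (fun h => hnr ((Submodule.Quotient.mk_eq_zero _).mp h))
  refine ⟨q, hq, fun a ha => hqn ?_, hqn ?_⟩
  · rw [Submodule.mem_colon_singleton, ← Submodule.Quotient.mk_smul, hn a ha]
    exact zero_mem _
  · rw [Submodule.mem_colon_singleton, ← Submodule.Quotient.mk_smul, Submodule.mem_bot,
      Submodule.Quotient.mk_eq_zero]
    exact Submodule.smul_mem_pointwise_smul _ _ _ trivial

theorem ringKrullDim_quotient_add_one_le {p q : Ideal A} [p.IsPrime] (hpq : p ≤ q) {r : A}
    (hrq : r ∈ q) (hrp : r ∉ p) : ringKrullDim (A ⧸ q) + 1 ≤ ringKrullDim (A ⧸ p) := by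
  refine ringKrullDim_succ_le_of_surjective (Ideal.Quotient.factor hpq)
    (Ideal.Quotient.factor_surjective hpq) (r := Ideal.Quotient.mk p r) ?_ ?_
  · rw [mem_nonZeroDivisors_iff_ne_zero]
    exact fun h => hrp (Ideal.Quotient.eq_zero_iff_mem.mp h)
  · rw [Ideal.Quotient.factor_mk]
    exact Ideal.Quotient.eq_zero_iff_mem.mpr hrq

/-- The depth of a module is at most the dimension of each of its associated primes. -/
theorem length_le_ringKrullDim_quotient_of_isWeaklyRegular [IsLocalRing A] [IsNoetherianRing A]
    {M : Type*} [AddCommGroup M] [Module A M] [Module.Finite A M] {p : Ideal A}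
    (hp : p ∈ associatedPrimes A M) {rs : List A} (hrs : ∀ r ∈ rs, r ∈ maximalIdeal A)
    (h : IsWeaklyRegular M rs) : (rs.length : WithBot ℕ∞) ≤ ringKrullDim (A ⧸ p) := by
  have hpp : p.IsPrime := IsAssociatedPrime.isPrime hp
  induction rs generalizing M p with
  | nil => simpa using ringKrullDim_nonneg_of_nontrivial
  | cons r rs ih =>
    rw [isWeaklyRegular_cons_iff] at h
    obtain ⟨q, hq, hpq, hrq⟩ :=
      exists_associatedPrime_quotSMulTop hp (hrs r List.mem_cons_self) h.1
    have h1 := ih hq (fun s hs => hrs s (List.mem_cons_of_mem r hs)) h.2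
      (IsAssociatedPrime.isPrime hq)
    have hrp : r ∉ p := by
      intro hrp
      have h2 : r ∈ ⋃ p ∈ associatedPrimes A M, (p : Set A) := Set.mem_biUnion hp hrp
      rw [biUnion_associatedPrimes_eq_compl_regular] at h2
      exact h2 h.1
    refine le_trans ?_ (ringKrullDim_quotient_add_one_le hpq hrq hrp)
    rw [List.length_cons, Nat.cast_add, Nat.cast_one]
    gcongr

/-- In a Cohen–Macaulay module every system of parameters is a regular sequence. -/
theorem isRegular_of_le_radical [IsLocalRing A] [IsNoetherianRing A]
    {M : Type*} [AddCommGroup M] [Module A M] [Module.Finite A M] [Nontrivial M] {us : List A}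
    (hus : ∀ u ∈ us, u ∈ maximalIdeal A) (hd : (us.length : ℕ∞) ≤ moduleDepth A M)
    (hrad : maximalIdeal A ≤ (Ideal.ofList us ⊔ Module.annihilator A M).radical) :
    IsRegular M us := by
  induction us generalizing M with
  | nil => exact IsRegular.nil A M
  | cons a us ih =>
    have ham := hus a List.mem_cons_self
    have hus' : ∀ u ∈ us, u ∈ maximalIdeal A := fun s hs => hus s (List.mem_cons_of_mem a hs)
    -- A zero divisor `a` lies in an associated prime `p`, and then `us` alone is primary modulo
    -- `p`. So the depth, which is at most `dim A/p`, would be at most `us.length`.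
    have hreg : IsSMulRegular M a := by
      by_contra hreg
      have h2 : a ∈ ⋃ p ∈ associatedPrimes A M, (p : Set A) := by
        rw [biUnion_associatedPrimes_eq_compl_regular]
        exact hreg
      obtain ⟨p, hp, hap⟩ := Set.mem_iUnion₂.mp h2
      obtain ⟨rs, h3, h4, h5⟩ := (natCast_le_moduleDepth_iff_exists M).mp hd
      have h6 := length_le_ringKrullDim_quotient_of_isWeaklyRegular hp h3 h4.toIsWeaklyRegular
      have h7 := ringKrullDim_quotient_le_length hus' (IsAssociatedPrime.isPrime hp).ne_top
        (hrad.trans (Ideal.radical_mono (by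
          rw [Ideal.ofList_cons]
          refine sup_le (sup_le ?_ le_sup_left)
            ((Submodule.annihilator_top (R := A) (M := M) ▸
              IsAssociatedPrime.annihilator_le hp).trans le_sup_right)
          exact (Ideal.span_singleton_le_iff_mem _).mpr (le_sup_right (a := Ideal.ofList us) hap))))
      have h8 : rs.length ≤ us.length := by exact_mod_cast h6.trans h7
      simp at h5
      omega
    have := nontrivial_quotSMulTop_of_mem_maximalIdeal M ham
    have hann := Module.annihilator_le_annihilator_quotSMulTop M a
    have hx : ∀ j, (a :: us).get j ∈ maximalIdeal A := fun j => hus _ (List.get_mem _ _)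
    have hspan : Ideal.span (Set.range (a :: us).get) = Ideal.ofList (a :: us) := by
      rw [Ideal.ofList]
      congr 1
      ext v
      exact List.mem_iff_get.symm
    refine IsRegular.cons hreg (ih hus' ?_ (hrad.trans (Ideal.radical_mono ?_)))
    · rw [natCast_le_moduleDepth_iff_koszulAcyclic (x := (a :: us).get) M hx
        (by rwa [hspan])] at hd
      -- The depth of `M/aM` is bounded below by Koszul homology of the same sequence `a :: us` on
      -- both modules, at the cost of one degree.
      rw [natCast_le_moduleDepth_iff_koszulAcyclic (x := (a :: us).get) _ hx
        (by rw [hspan]; exact hrad.trans (Ideal.radical_mono (sup_le_sup_left hann _)))]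
      intro i hi
      have hl : (a :: us).length = us.length + 1 := rfl
      exact KoszulAcyclic.quotSMulTop hreg (hd i (by omega)) fun j hj => hd j (by omega)
    · rw [Ideal.ofList_cons]
      refine sup_le (sup_le ?_ le_sup_left) (hann.trans le_sup_right)
      exact (Ideal.span_singleton_le_iff_mem _).mpr
        (le_sup_right (a := Ideal.ofList us) (QuotSMulTop.mem_annihilator M a))

/-- An ideal that contains a regular sequence of length `n` has height at least `n`. -/
theorem length_le_height_of_isWeaklyRegular [IsNoetherianRing A] {I : Ideal A} {rs : List A}
    (hrs : ∀ r ∈ rs, r ∈ I) (h : IsWeaklyRegular A rs) : (rs.length : ℕ∞) ≤ I.height := by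
  rw [Ideal.height_eq_inf_minimalPrimes]
  refine le_iInf₂ fun p hp => ?_
  have hpp : p.IsPrime := hp.1.1
  -- After localizing at a minimal prime `p` of `I` the sequence stays regular, so `dim A_p` is its
  -- length plus the dimension of a nonzero quotient.
  have h1 := h.isRegular_of_isLocalization_of_mem (Localization.AtPrime p) p
    fun r hr => hp.1.2 (hrs r hr)
  have h2 := ringKrullDim_add_length_eq_ringKrullDim_of_isRegular _ h1
  rw [IsLocalization.AtPrime.ringKrullDim_eq_height p (Localization.AtPrime p),
    List.length_map] at h2
  have h3 : Nontrivial (Localization.AtPrime p ⧸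
      Ideal.ofList (rs.map (algebraMap A (Localization.AtPrime p)))) := by
    rw [Ideal.Quotient.nontrivial_iff]
    intro htop
    exact h1.top_ne_smul (by rw [htop]; simp)
  have h4 : (0 : WithBot ℕ∞) ≤ ringKrullDim (Localization.AtPrime p ⧸
      Ideal.ofList (rs.map (algebraMap A (Localization.AtPrime p)))) :=
    ringKrullDim_nonneg_of_nontrivial
  have h5 : ((rs.length : ℕ∞) : WithBot ℕ∞) ≤ p.height := by
    rw [← h2]
    exact le_add_of_nonneg_left h4
  exact_mod_cast h5

theorem isFiniteLength_of_le_radical_annihilator [IsLocalRing A] [IsNoetherianRing A]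
    {M : Type*} [AddCommGroup M] [Module A M] [Module.Finite A M]
    (h : maximalIdeal A ≤ (Module.annihilator A M).radical) : IsFiniteLength A M := by
  cases subsingleton_or_nontrivial M
  · exact .of_subsingleton
  have hne : Module.annihilator A M ≠ ⊤ := fun h => not_subsingleton M
    (Module.annihilator_eq_top_iff.mp h)
  have : IsArtinianRing (A ⧸ Module.annihilator A M) :=
    IsLocalRing.quotient_artinian_of_mem_minimalPrimes_of_isLocalRing _
      (mem_minimalPrimes_of_le_radical (le_maximalIdeal hne) h)
  let _ := Module.IsTorsionBySet.module (R := A) (M := M) (I := Module.annihilator A M)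
    (fun m a => Module.mem_annihilator.mp a.2 m)
  have : IsScalarTower A (A ⧸ Module.annihilator A M) M :=
    Module.IsTorsionBySet.isScalarTower _
  have hfin : Module.Finite (A ⧸ Module.annihilator A M) M :=
    Module.Finite.of_restrictScalars_finite A _ M
  rw [← Module.length_ne_top_iff,
    Module.length_eq_of_surjective (S := A) (R := A ⧸ Module.annihilator A M)
      Ideal.Quotient.mk_surjective]
  exact Module.length_ne_top

end CohenMacaulay

/-! ### Ext along regular sequences (Rees). -/

section ExtRegular

open CategoryTheory CategoryTheory.Abelian RingTheory.Sequence

variable {A : Type u} [CommRing A]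

theorem Ext_smul_eq_zero {M N : ModuleCat.{u} A} {r : A} (hr : r ∈ Module.annihilator A M)
    {n : ℕ} (e : Ext.{u} M N n) : r • e = 0 := by
  have h : r • 𝟙 M = 0 := by
    ext m
    exact Module.mem_annihilator.mp hr m
  rw [← Ext.mk₀_id_comp e, ← Ext.smul_comp, ← Ext.mk₀_smul, h, Ext.mk₀_zero, Ext.zero_comp]

/-- Ext into `N` shifts down along an `N`-regular element that kills `M`. -/
theorem nonempty_Ext_succ_equiv {M N : ModuleCat.{u} A} {r : A}
    (hr : r ∈ Module.annihilator A M) (hN : IsSMulRegular N r) {n : ℕ}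
    (h : Subsingleton (Ext.{u} M N n)) :
    Nonempty (Ext.{u} M (ModuleCat.of A (QuotSMulTop r N)) n ≃ₗ[A] Ext.{u} M N (n + 1)) := by
  have hS := hN.smulShortComplex_shortExact
  refine ⟨LinearEquiv.ofBijective (Ext.postcompOfLinear hS.extClass A M rfl) ⟨?_, fun e => ?_⟩⟩
  · rw [← LinearMap.ker_eq_bot, LinearMap.ker_eq_bot']
    intro e he
    obtain ⟨e', rfl⟩ := Ext.covariant_sequence_exact₃ M hS e rfl he
    have he' : e' = (0 : Ext M (N.smulShortComplex r).X₂ n) := h.elim _ _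
    rw [he', Ext.zero_comp]
  -- Multiplication by `r` is zero on `Ext(M, N)` because `r` kills `M`; hence the connecting map is
  -- onto.
  · have h0 : ∀ e : Ext M N (n + 1), e.comp (Ext.mk₀ (r • 𝟙 N)) (add_zero _) = 0 := fun e => by
      rw [Ext.mk₀_smul, Ext.comp_smul, Ext.comp_mk₀_id]
      exact Ext_smul_eq_zero hr e
    exact Ext.covariant_sequence_exact₁ M hS e (h0 e) rfl

theorem subsingleton_Ext_of_isWeaklyRegular {M N : ModuleCat.{u} A} {rs : List A}
    (hrs : ∀ r ∈ rs, r ∈ Module.annihilator A M) (hN : IsWeaklyRegular N rs) {n : ℕ}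
    (hn : n < rs.length) : Subsingleton (Ext.{u} M N n) := by
  induction rs generalizing N n with
  | nil => simp at hn
  | cons r rs ih =>
    rw [isWeaklyRegular_cons_iff] at hN
    induction n with
    | zero =>
      have : Subsingleton (M →ₗ[A] N) :=
        hN.1.linearMap_subsingleton_of_mem_annihilator (hrs r List.mem_cons_self)
      have : Subsingleton (M ⟶ N) := ModuleCat.homEquiv.subsingleton
      exact (Ext.addEquiv₀ (X := M) (Y := N)).toEquiv.subsingleton
    | succ n ihn =>
      obtain ⟨e⟩ := nonempty_Ext_succ_equiv (hrs r List.mem_cons_self) hN.1 (ihn (by omega))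
      have := ih (N := ModuleCat.of A (QuotSMulTop r N))
        (fun s hs => hrs s (List.mem_cons_of_mem r hs)) hN.2 (n := n) (by simpa using hn)
      exact e.symm.toEquiv.subsingleton

/-- Rees: `Ext^n(M, N) = Hom(M, N / (r₁, …, r_n) N)` for an `N`-regular sequence that kills `M`. -/
theorem nonempty_Ext_equiv_of_isWeaklyRegular {M N : ModuleCat.{u} A} {rs : List A}
    (hrs : ∀ r ∈ rs, r ∈ Module.annihilator A M) (hN : IsWeaklyRegular N rs) :
    Nonempty (Ext.{u} M N rs.length ≃ₗ[A]
      (M →ₗ[A] (N ⧸ (Ideal.ofList rs • ⊤ : Submodule A N)))) := by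
  induction rs generalizing N with
  | nil =>
    refine ⟨Ext.linearEquiv₀.trans (ModuleCat.homLinearEquiv.trans
      (LinearEquiv.congrRight (Submodule.quotEquivOfEqBot _ ?_).symm))⟩
    rw [Ideal.ofList_nil, Submodule.bot_smul]
  | cons r rs ih =>
    have h0 := subsingleton_Ext_of_isWeaklyRegular hrs hN (n := rs.length) (by simp)
    rw [isWeaklyRegular_cons_iff] at hN
    obtain ⟨e⟩ := nonempty_Ext_succ_equiv (hrs r List.mem_cons_self) hN.1 h0
    obtain ⟨e'⟩ := ih (N := ModuleCat.of A (QuotSMulTop r N))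
      (fun s hs => hrs s (List.mem_cons_of_mem r hs)) hN.2
    exact ⟨e.symm.trans (e'.trans (LinearEquiv.congrRight
      (Submodule.quotOfListConsSMulTopEquivQuotSMulTopInner N r rs).symm))⟩

end ExtRegular

/-! ### Artinian rings with simple socle. -/

section GorensteinDuality

open IsLocalRing RingTheory.Sequence CategoryTheory

/-- Left exactness of `Hom(-, T)` propagates the bound from the residue field along a composition
series. -/
theorem length_Hom_le_of_isFiniteLength {A : Type*} [CommRing A] [IsLocalRing A]
    {T : Type*} [AddCommGroup T] [Module A T]
    (hT : Module.length A ((A ⧸ maximalIdeal A) →ₗ[A] T) ≤ 1)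
    {X : Type*} [AddCommGroup X] [Module A X] (hX : IsFiniteLength A X) :
    Module.length A (X →ₗ[A] T) ≤ Module.length A X := by
  induction hX with
  | @of_subsingleton X _ _ _ =>
    have : Subsingleton (X →ₗ[A] T) :=
      ⟨fun f g => LinearMap.ext fun v => by rw [Subsingleton.elim v 0, map_zero, map_zero]⟩
    rw [Module.length_eq_zero]
    exact zero_le
  | @of_simple_quotient X _ _ N hs _ ih =>
    have hq : Module.length A ((X ⧸ N) →ₗ[A] T) ≤ 1 := by
      obtain ⟨m, hm, ⟨e⟩⟩ := isSimpleModule_iff_quot_maximal.mp hs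
      rw [eq_maximalIdeal hm] at e
      rwa [(LinearEquiv.congrLeft T A e).length_eq]
    rw [Module.length_eq_add_of_exact N.subtype N.mkQ N.injective_subtype N.mkQ_surjective
      (LinearMap.exact_subtype_mkQ N), Module.length_eq_one A (X ⧸ N), add_comm,
      Module.length_eq_add_of_exact (LinearMap.lcomp A T N.mkQ)
        (LinearMap.lcomp A T N.subtype).rangeRestrict ?_ (LinearMap.surjective_rangeRestrict _) ?_]
    · refine add_le_add hq (le_trans ?_ ih)
      exact Module.length_le_of_injective (Submodule.subtype _) (Submodule.subtype_injective _)
    · intro f g hfg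
      exact LinearMap.ext fun v => by
        obtain ⟨w, rfl⟩ := N.mkQ_surjective v
        exact LinearMap.congr_fun hfg w
    · intro f
      constructor
      · intro hf
        have hf' : ∀ n ∈ N, f n = 0 := fun n hn =>
          LinearMap.congr_fun (congrArg Subtype.val hf) ⟨n, hn⟩
        exact ⟨N.liftQ f hf', LinearMap.ext fun v => rfl⟩
      · rintro ⟨g, rfl⟩
        refine Subtype.ext (LinearMap.ext fun n => ?_)
        change g (N.mkQ n) = 0
        rw [(Submodule.Quotient.mk_eq_zero N).mpr n.2 |> fun h => (show N.mkQ n = 0 from h), map_zero]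

/-- The double annihilator property of an Artinian local ring with simple socle. -/
theorem exists_smul_eq_mk_of_forall_smul_eq_zero {A : Type*} [CommRing A] [IsLocalRing A]
    {I : Ideal A} (hI : IsFiniteLength A (A ⧸ I))
    (hT : Module.length A ((A ⧸ maximalIdeal A) →ₗ[A] (A ⧸ I)) ≤ 1) {c v : A}
    (h : ∀ t : A ⧸ I, c • t = 0 → v • t = 0) : ∃ t : A ⧸ I, c • t = Ideal.Quotient.mk I v := by
  have hnA := isFiniteLength_iff_isNoetherian_isArtinian.mp hI
  have := hnA.1
  have := hnA.2
  set φ := LinearMap.lsmul A (A ⧸ I) c with hφ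
  set K := LinearMap.ker φ with hK
  have hKm : ∀ t ∈ K, c • t = 0 := fun t ht => ht
  -- `J` is the annihilator of `K = (0 : c)` and contains the image of `c`. It embeds in
  -- `Hom((A/I)/K, A/I)`, whose length is at most that of `(A/I)/K ≅ c(A/I)`; so the two agree.
  set J : Submodule A (A ⧸ I) :=
    { carrier := {j | ∀ t ∈ K, j * t = 0}
      add_mem' := fun h h' t ht => by rw [add_mul, h t ht, h' t ht, add_zero]
      zero_mem' := fun t _ => zero_mul t
      smul_mem' := fun b j h t ht => by rw [smul_mul_assoc, h t ht, smul_zero] } with hJ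
  set ψ : J →ₗ[A] (((A ⧸ I) ⧸ K) →ₗ[A] (A ⧸ I)) :=
    { toFun := fun j => K.liftQ (LinearMap.mulLeft A (j : A ⧸ I)) fun t ht => j.2 t ht
      map_add' := fun j j' => LinearMap.ext fun v => by
        obtain ⟨w, rfl⟩ := Submodule.Quotient.mk_surjective K v
        exact add_mul _ _ _
      map_smul' := fun b j => LinearMap.ext fun v => by
        obtain ⟨w, rfl⟩ := Submodule.Quotient.mk_surjective K v
        exact smul_mul_assoc _ _ _ } with hψ
  have hψi : Function.Injective ψ := by
    intro j j' hjj
    have h1 : (j : A ⧸ I) * 1 = j' * 1 :=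
      LinearMap.congr_fun hjj (Submodule.Quotient.mk (p := K) 1)
    rw [mul_one, mul_one] at h1
    exact Subtype.ext h1
  have hlen : Module.length A J ≤ Module.length A (LinearMap.range φ) := by
    rw [← (LinearMap.quotKerEquivRange φ).length_eq]
    exact (Module.length_le_of_injective ψ hψi).trans
      (length_Hom_le_of_isFiniteLength hT (IsFiniteLength.of_surjective hI K.mkQ_surjective))
  have hle : LinearMap.range φ ≤ J := by
    rintro _ ⟨s, rfl⟩ t ht
    rw [hφ, LinearMap.lsmul_apply, smul_mul_assoc, mul_comm, ← smul_mul_assoc, hKm t ht, zero_mul]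
  have htop : (LinearMap.range φ).submoduleOf J = ⊤ := by
    by_contra hne
    have h1 := Submodule.length_lt hne
    rw [(Submodule.submoduleOfEquivOfLe hle).length_eq] at h1
    exact absurd hlen h1.not_ge
  have hv : Ideal.Quotient.mk I v ∈ J := by
    intro t ht
    have h1 := h t ht
    rwa [Algebra.smul_def] at h1
  have h2 : (⟨_, hv⟩ : J) ∈ (LinearMap.range φ).submoduleOf J := by
    rw [htop]
    trivial
  exact h2

theorem exists_list_ofList_eq_maximalIdeal {A : Type*} [CommRing A] [IsRegularLocalRing A] {N : ℕ}
    (hN : ringKrullDim A = N) :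
    ∃ us : List A, us.length = N ∧ Ideal.ofList us = maximalIdeal A := by
  have hfg := (maximalIdeal A).fg_of_isNoetherianRing
  have hfin := Submodule.FG.finite_generators hfg
  refine ⟨hfin.toFinset.toList, ?_, ?_⟩
  · have h1 := IsRegularLocalRing.spanFinrank_maximalIdeal (R := A)
    rw [hN] at h1
    rw [Finset.length_toList, ← Set.ncard_eq_toFinset_card _ hfin,
      Submodule.FG.generators_ncard hfg]
    exact_mod_cast h1
  · simp only [Ideal.ofList, Finset.mem_toList, Set.Finite.mem_toFinset, Set.ofPred_mem_eq]
    exact (maximalIdeal A).span_generators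

/-- A complete intersection of dimension zero in a regular local ring has simple socle. -/
theorem length_Hom_residueField_le_one {A : Type u} [CommRing A] [IsRegularLocalRing A]
    {zs : List A} (hdim : ringKrullDim A = zs.length) (hd : (zs.length : ℕ∞) ≤ moduleDepth A A)
    (hzs : IsRegular A zs) (hm : ∀ z ∈ zs, z ∈ maximalIdeal A) :
    Module.length A ((A ⧸ maximalIdeal A) →ₗ[A] (A ⧸ Ideal.ofList zs)) ≤ 1 := by
  obtain ⟨us, hl, hu⟩ := exists_list_ofList_eq_maximalIdeal hdim
  have hum : ∀ u ∈ us, u ∈ maximalIdeal A := fun u hu' => hu ▸ Ideal.subset_span hu'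
  have hur : IsRegular A us := isRegular_of_le_radical hum (by rwa [hl])
    (by rw [hu]; exact le_sup_left.trans Ideal.le_radical)
  obtain ⟨e⟩ := nonempty_Ext_equiv_of_isWeaklyRegular
    (M := ModuleCat.of A (A ⧸ maximalIdeal A)) (N := ModuleCat.of A A) (rs := zs)
    (fun z hz => by rw [Ideal.annihilator_quotient]; exact hm z hz) hzs.toIsWeaklyRegular
  obtain ⟨e'⟩ := nonempty_Ext_equiv_of_isWeaklyRegular
    (M := ModuleCat.of A (A ⧸ maximalIdeal A)) (N := ModuleCat.of A A) (rs := us)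
    (fun z hz => by rw [Ideal.annihilator_quotient]; exact hum z hz) hur.toIsWeaklyRegular
  rw [hl] at e'
  have htop : ∀ I : Ideal A, I • (⊤ : Submodule A A) = I := fun I => by simp
  -- Both sides compute `Ext^{dim A}(A/𝔪, A)`: one by `zs`, the other by a regular system of
  -- parameters `us`, modulo which `A` is the residue field.
  have e1 : ((A ⧸ maximalIdeal A) →ₗ[A] (A ⧸ Ideal.ofList zs)) ≃ₗ[A]
      ((A ⧸ maximalIdeal A) →ₗ[A] (A ⧸ maximalIdeal A)) :=
    (LinearEquiv.congrRight (Submodule.quotEquivOfEq _ _ (htop _)).symm).trans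
      (e.symm.trans (e'.trans (LinearEquiv.congrRight
        (Submodule.quotEquivOfEq _ _ ((htop _).trans hu)))))
  rw [e1.length_eq]
  have : IsSimpleModule A (A ⧸ maximalIdeal A) :=
    isSimpleModule_iff_quot_maximal.mpr ⟨_, inferInstance, ⟨LinearEquiv.refl _ _⟩⟩
  rw [← Module.length_eq_one A (A ⧸ maximalIdeal A)]
  refine Module.length_le_of_injective
    (LinearMap.applyₗ (R := A) (M₂ := A ⧸ maximalIdeal A) (1 : A ⧸ maximalIdeal A)) ?_
  intro f g hfg
  refine LinearMap.ext fun t => ?_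
  obtain ⟨a, rfl⟩ := Ideal.Quotient.mk_surjective t
  have h1 : Ideal.Quotient.mk (maximalIdeal A) a = a • (1 : A ⧸ maximalIdeal A) := by
    rw [Algebra.smul_def, mul_one]
    rfl
  rw [h1, map_smul, map_smul]
  exact congrArg (a • ·) hfg

end GorensteinDuality

/-! ### The Monomial Conjecture for parameters of an almost complete intersection. -/

section MonomialConjecture

open IsLocalRing RingTheory.Sequence

variable {A : Type*} [CommRing A] {d : ℕ} {x : Fin d → A}

theorem prod_pow_mul_mem {J : Ideal A} {t : ℕ} {a : A} (ha : a ∈ Ideal.span (Set.range x) ⊔ J) :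
    (∏ i, x i ^ t) * a ∈ Ideal.span (Set.range fun i => x i ^ (t + 1)) ⊔ J := by
  set I : Ideal A := Submodule.comap (LinearMap.lsmul A A (∏ i, x i ^ t))
    (Ideal.span (Set.range fun i => x i ^ (t + 1)) ⊔ J) with hI
  suffices h : Ideal.span (Set.range x) ⊔ J ≤ I from h ha
  refine sup_le (Ideal.span_le.mpr ?_) fun b hb => ?_
  · rintro _ ⟨i, rfl⟩
    change (∏ i, x i ^ t) * x i ∈ Ideal.span (Set.range fun i => x i ^ (t + 1)) ⊔ J
    rw [← Finset.mul_prod_erase _ _ (Finset.mem_univ i), mul_right_comm, ← pow_succ]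
    exact Ideal.mul_mem_right _ _ (le_sup_left (b := J) (Ideal.subset_span ⟨i, rfl⟩))
  · exact Ideal.mul_mem_left _ _ (le_sup_right (b := J) hb)

/-- The hypothesis that `x` and `ys` together form a system of parameters of a Cohen–Macaulay
local ring. -/
structure IsParameterSystem [IsLocalRing A] (x : Fin d → A) (ys : List A) : Prop where
  mem_x : ∀ i, x i ∈ maximalIdeal A
  mem_y : ∀ y ∈ ys, y ∈ maximalIdeal A
  le_depth : ((d + ys.length : ℕ) : ℕ∞) ≤ moduleDepth A A
  le_radical : maximalIdeal A ≤ (Ideal.span (Set.range x) ⊔ Ideal.ofList ys).radical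

theorem IsParameterSystem.isRegular [IsLocalRing A] [IsNoetherianRing A] {ys : List A}
    (h : IsParameterSystem x ys) {zs : List A} (hz : ∀ z ∈ zs, z ∈ maximalIdeal A)
    (hl : zs.length = d + ys.length) (hx : ∀ i, ∃ n, x i ^ n ∈ Ideal.ofList zs)
    (hy : ∀ y ∈ ys, y ∈ Ideal.ofList zs) :
    IsRegular A zs ∧ maximalIdeal A ≤ (Ideal.ofList zs).radical := by
  have h1 : maximalIdeal A ≤ (Ideal.ofList zs).radical := by
    refine h.le_radical.trans (Ideal.radical_le_radical_iff.mpr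
      (sup_le (Ideal.span_le.mpr ?_) (Ideal.span_le.mpr fun y hy' => Ideal.le_radical (hy y hy'))))
    rintro _ ⟨i, rfl⟩
    exact hx i
  exact ⟨isRegular_of_le_radical hz (by rw [hl]; exact h.le_depth)
    (h1.trans (Ideal.radical_mono le_sup_left)), h1⟩

theorem IsParameterSystem.mem_of_prod_pow_mul_mem [IsLocalRing A] [IsNoetherianRing A]
    {ys : List A} (h : IsParameterSystem x ys) {t : ℕ} {a : A}
    (ha : (∏ i, x i ^ t) * a ∈ Ideal.span (Set.range fun i => x i ^ (t + 1)) ⊔ Ideal.ofList ys) :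
    a ∈ Ideal.span (Set.range x) ⊔ Ideal.ofList ys := by
  classical
  -- The exponents drop from `t + 1` to `1` one index at a time. Each mixed set of powers together
  -- with `ys` is a system of parameters, so `x k` is regular modulo the other members and `x k ^ t`
  -- cancels.
  have key : ∀ F : Finset (Fin d), ∀ a, (∏ i ∈ F, x i ^ t) * a ∈
      Ideal.span (Set.range fun i => x i ^ (if i ∈ F then t + 1 else 1)) ⊔ Ideal.ofList ys →
      a ∈ Ideal.span (Set.range x) ⊔ Ideal.ofList ys := by
    intro F
    induction F using Finset.induction_on with
    | empty => intro a ha; simpa using ha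
    | insert k F hk ih =>
      intro a ha
      refine ih a ?_
      rw [Finset.prod_insert hk, mul_assoc] at ha
      set w := (∏ i ∈ F, x i ^ t) * a with hw
      set e : Fin d → ℕ := fun i => if i ∈ F then t + 1 else 1 with he
      have hepos : ∀ i, e i ≠ 0 := fun i => by
        simp only [he]
        split_ifs <;> omega
      set L : List A := ((Finset.univ.erase k).toList.map fun i => x i ^ e i) ++ ys with hL
      have hLx : ∀ i, i ≠ k → x i ^ e i ∈ Ideal.ofList L := fun i hi =>
        Ideal.subset_span (List.mem_append_left _ (List.mem_map.mpr ⟨i, by simp [hi], rfl⟩))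
      have hLy : Ideal.ofList ys ≤ Ideal.ofList L :=
        Ideal.span_mono fun y hy => List.mem_append_right _ hy
      have hreg : IsRegular A (L ++ [x k]) := by
        have hle : Ideal.ofList L ≤ Ideal.ofList (L ++ [x k]) :=
          Ideal.span_mono fun y hy => List.mem_append_left _ hy
        refine (h.isRegular ?_ ?_ ?_ fun y hy => hle (hLy (Ideal.subset_span hy))).1
        · intro z hz
          rw [List.mem_append, hL, List.mem_append, List.mem_map, List.mem_singleton] at hz
          rcases hz with (⟨i, -, rfl⟩ | hz) | rfl
          · exact Ideal.pow_mem_of_mem _ (h.mem_x i) _ (Nat.pos_of_ne_zero (hepos i))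
          · exact h.mem_y z hz
          · exact h.mem_x k
        · have := k.pos
          simp [hL, Finset.card_erase_of_mem]
          omega
        · intro i
          by_cases hi : i = k
          · subst hi
            exact ⟨1, by rw [pow_one]; exact Ideal.subset_span (List.mem_append_right _ (by simp))⟩
          · exact ⟨e i, hle (hLx i hi)⟩
      have hk' : IsSMulRegular (A ⧸ Ideal.ofList L) (x k) := by
        have h1 := ((isWeaklyRegular_append_iff _ _ _).mp hreg.toIsWeaklyRegular).2
        rw [isWeaklyRegular_singleton_iff] at h1
        exact ((Submodule.quotEquivOfEq (Ideal.ofList L • (⊤ : Submodule A A)) (Ideal.ofList L)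
          (by simp)).isSMulRegular_congr (x k)).mp h1
      have ha' : x k ^ t * w ∈ Ideal.span {x k ^ (t + 1)} ⊔ Ideal.ofList L := by
        refine (sup_le (Ideal.span_le.mpr ?_) (hLy.trans le_sup_right)) ha
        rintro _ ⟨i, rfl⟩
        by_cases hi : i = k
        · subst hi
          exact le_sup_left (b := Ideal.ofList L) (Ideal.subset_span (by simp))
        · have := hLx i hi
          simp only [he] at this
          simpa [hi] using le_sup_right (a := Ideal.span {x k ^ (t + 1)}) this
      obtain ⟨b, hb, v, hv, hbv⟩ := Submodule.mem_sup.mp ha'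
      obtain ⟨c, rfl⟩ := Ideal.mem_span_singleton'.mp hb
      have h2 : x k ^ t * (w - c * x k) ∈ Ideal.ofList L := by
        have : x k ^ t * (w - c * x k) = v := by
          rw [mul_sub, ← hbv]
          ring
        rwa [this]
      have h3 : w - c * x k ∈ Ideal.ofList L :=
        mem_of_isSMulRegular_quotient_of_smul_mem (hk'.pow t) h2
      have h4 : Ideal.ofList L ≤ Ideal.span (Set.range fun i => x i ^ e i) ⊔ Ideal.ofList ys := by
        refine Ideal.span_le.mpr fun z hz => ?_
        rcases List.mem_append.mp hz with hz | hz
        · obtain ⟨i, -, rfl⟩ := List.mem_map.mp hz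
          exact le_sup_left (b := Ideal.ofList ys) (Ideal.subset_span ⟨i, rfl⟩)
        · exact le_sup_right (b := Ideal.ofList ys) (Ideal.subset_span hz)
      have h5 : x k ∈ Ideal.span (Set.range fun i => x i ^ e i) ⊔ Ideal.ofList ys :=
        le_sup_left (b := Ideal.ofList ys) (Ideal.subset_span ⟨k, by simp [he, hk]⟩)
      have h6 := add_mem (h4 h3) (Ideal.mul_mem_left _ c h5)
      rwa [sub_add_cancel] at h6
  exact key Finset.univ a (by simpa using ha)

theorem satisfiesMonomialConjecture_mk_iff {I : Ideal A} :
    SatisfiesMonomialConjecture (fun i => Ideal.Quotient.mk I (x i)) ↔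
      ∀ t : ℕ, 1 ≤ t → ∏ i, x i ^ t ∉ Ideal.span (Set.range fun i => x i ^ (t + 1)) ⊔ I := by
  refine forall_congr' fun t => imp_congr_right fun _ => not_congr ?_
  rw [← Ideal.mem_quotient_iff_mem_sup, Ideal.map_span, ← Set.range_comp]
  simp [Function.comp_def]

/-- A form of the lemma of Artin and Rees. -/
theorem exists_forall_mem_of_mul_mem_pow_sup [IsNoetherianRing A] (X J : Ideal A) (l : A) :
    ∃ n : ℕ, 1 ≤ n ∧ ∀ a, l * a ∈ X ^ (n + 1) ⊔ J → ∃ b ∈ X ⊔ J, l * (a - b) ∈ J := by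
  set φ := LinearMap.lsmul A (A ⧸ J) l with hφ
  -- Artin–Rees for `l(A/J) ⊆ A/J` puts every `l a` in `X^{k+2}(A/J)` into `X² l(A/J)`, hence into
  -- `l X(A/J)`. Taking `n = k + 1` instead of `k` only secures `1 ≤ n`.
  obtain ⟨k, hk⟩ := X.exists_pow_inf_eq_pow_smul (LinearMap.range φ)
  refine ⟨k + 1, by omega, fun a ha => ?_⟩
  have hmem : ∀ (n : ℕ) (b : A), b ∈ X ^ n ⊔ J →
      Submodule.Quotient.mk b ∈ (X ^ n • ⊤ : Submodule A (A ⧸ J)) := by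
    intro n b hb
    obtain ⟨c, hc, v, hv, rfl⟩ := Submodule.mem_sup.mp hb
    have h1 : (Submodule.Quotient.mk (c + v) : A ⧸ J) = c • Submodule.Quotient.mk 1 := by
      rw [← Submodule.Quotient.mk_smul, Submodule.Quotient.eq]
      simpa using hv
    rw [h1]
    exact Submodule.smul_mem_smul hc trivial
  have h1 : (Submodule.Quotient.mk (l * a) : A ⧸ J) ∈
      X ^ (k + 1 + 1) • (⊤ : Submodule A (A ⧸ J)) ⊓ LinearMap.range φ :=
    ⟨hmem _ _ ha, Submodule.Quotient.mk a, rfl⟩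
  rw [hk _ (by omega)] at h1
  have h2 : X ^ (k + 1 + 1 - k) • (X ^ k • (⊤ : Submodule A (A ⧸ J)) ⊓ LinearMap.range φ) ≤
      (X • (⊤ : Submodule A (A ⧸ J))).map φ := by
    rw [Submodule.map_smul'', Submodule.map_top]
    exact Submodule.smul_mono (Ideal.pow_le_self (by omega)) inf_le_right
  obtain ⟨b', hb', hbl⟩ := h2 h1
  obtain ⟨b, rfl⟩ := Submodule.Quotient.mk_surjective _ b'
  refine ⟨b, ?_, ?_⟩
  · have h3 : X • (⊤ : Submodule A (A ⧸ J)) ≤ Submodule.map J.mkQ (X ⊔ J) := by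
      rw [Submodule.smul_le]
      rintro r hr t -
      obtain ⟨c, rfl⟩ := Submodule.Quotient.mk_surjective _ t
      exact ⟨r * c, Ideal.mul_mem_right _ _ (le_sup_left (b := J) hr), rfl⟩
    obtain ⟨c, hc, hcb⟩ := h3 hb'
    have h4 : c - b ∈ J := (Submodule.Quotient.eq J).mp hcb
    have h5 := sub_mem hc (le_sup_right (a := X) h4)
    rwa [sub_sub_cancel] at h5
  · have h4 : b • l - a • l ∈ J := by
      have h5 : (Submodule.Quotient.mk (l * b) : A ⧸ J) = Submodule.Quotient.mk (l * a) := hbl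
      rw [Submodule.Quotient.eq] at h5
      simpa [mul_comm] using h5
    rw [← neg_mem_iff]
    convert h4 using 1
    simp only [smul_eq_mul]
    ring

end MonomialConjecture

section MonomialConjectureIff

open IsLocalRing RingTheory.Sequence

/-- The monomial conjecture for `x` in the almost complete intersection `A / (l, ys)`. -/
theorem IsParameterSystem.satisfiesMonomialConjecture_iff {A : Type u} [CommRing A]
    [IsRegularLocalRing A] {d : ℕ} {x : Fin d → A} {ys : List A} (h : IsParameterSystem x ys)
    (hdim : ringKrullDim A = ((d + ys.length : ℕ) : WithBot ℕ∞)) (l : A) :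
    SatisfiesMonomialConjecture
        (fun i => Ideal.Quotient.mk (Ideal.span {l} ⊔ Ideal.ofList ys) (x i)) ↔
      ∃ a, l * a ∈ Ideal.ofList ys ∧ a ∉ Ideal.span (Set.range x) ⊔ Ideal.ofList ys := by
  rw [satisfiesMonomialConjecture_mk_iff]
  have hsup : ∀ I : Ideal A, I ⊔ (Ideal.span {l} ⊔ Ideal.ofList ys) =
      Ideal.span {l} ⊔ (I ⊔ Ideal.ofList ys) := fun I => sup_left_comm _ _ _
  constructor
  · intro hMC
    by_contra! hcon
    obtain ⟨t, ht, hAR⟩ :=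
      exists_forall_mem_of_mul_mem_pow_sup (Ideal.span (Set.range x)) (Ideal.ofList ys) l
    set Q := Ideal.span (Set.range fun i => x i ^ (t + 1)) ⊔ Ideal.ofList ys with hQ
    set zs : List A := List.ofFn (fun i => x i ^ (t + 1)) ++ ys with hzs
    have hzQ : Ideal.ofList zs = Q := by
      rw [hzs, Ideal.ofList_append, hQ]
      congr 1
      simp [Ideal.ofList, List.mem_ofFn', Set.range]
    have hzm : ∀ z ∈ zs, z ∈ maximalIdeal A := by
      intro z hz
      rw [hzs, List.mem_append, List.mem_ofFn'] at hz
      rcases hz with ⟨i, rfl⟩ | hz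
      · exact Ideal.pow_mem_of_mem _ (h.mem_x i) _ (Nat.succ_pos t)
      · exact h.mem_y z hz
    have hzl : zs.length = d + ys.length := by simp [hzs]
    obtain ⟨hzr, hzrad⟩ := h.isRegular hzm hzl
      (fun i => ⟨t + 1, by
        rw [hzQ]
        exact le_sup_left (b := Ideal.ofList ys)
          (Ideal.subset_span (Set.mem_range_self (f := fun i => x i ^ (t + 1)) i))⟩)
      (fun y hy => by
        rw [hzQ]
        exact le_sup_right (b := Ideal.ofList ys) (Ideal.subset_span hy))
    have hsoc := length_Hom_residueField_le_one (by rw [hzl]; exact hdim)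
      (by rw [hzl]; exact h.le_depth) hzr hzm
    rw [hzQ] at hsoc hzrad
    have hfl : IsFiniteLength A (A ⧸ Q) :=
      isFiniteLength_of_le_radical_annihilator (by rwa [Ideal.annihilator_quotient])
    refine hMC t ht ?_
    -- If `l a ∈ Q`, Artin–Rees and `hcon` give `a ∈ (x) + (ys)`, so `∏ x_i^t · a ∈ Q`. The double
    -- annihilator property then writes the product as a multiple of `l` modulo `Q`, contradicting
    -- `hMC`.
    obtain ⟨s, hs⟩ := exists_smul_eq_mk_of_forall_smul_eq_zero (c := l) (v := ∏ i, x i ^ t)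
      hfl hsoc (by
        intro s hs
        obtain ⟨a, rfl⟩ := Ideal.Quotient.mk_surjective s
        rw [Algebra.smul_def, Ideal.Quotient.algebraMap_eq, ← map_mul,
          Ideal.Quotient.eq_zero_iff_mem] at hs ⊢
        have hpow : Q ≤ Ideal.span (Set.range x) ^ (t + 1) ⊔ Ideal.ofList ys := by
          refine sup_le_sup_right (Ideal.span_le.mpr ?_) _
          rintro _ ⟨i, rfl⟩
          exact Ideal.pow_mem_pow (Ideal.subset_span (Set.mem_range_self i)) _
        obtain ⟨b, hb, hab⟩ := hAR a (hpow hs)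
        refine prod_pow_mul_mem ?_
        have := add_mem (hcon _ hab) hb
        rwa [sub_add_cancel] at this)
    obtain ⟨c, rfl⟩ := Ideal.Quotient.mk_surjective s
    rw [Algebra.smul_def, Ideal.Quotient.algebraMap_eq, ← map_mul, Ideal.Quotient.eq] at hs
    rw [hsup, ← hQ]
    have h1 := sub_mem (Ideal.mul_mem_right c _
      (le_sup_left (b := Q) (Ideal.mem_span_singleton_self l))) (le_sup_right (a := Ideal.span {l}) hs)
    rwa [sub_sub_cancel] at h1
  · rintro ⟨a, hla, ha⟩ t - hmem
    -- Multiplying the membership of the product by `a` absorbs the `l`-term into `(ys)`.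
    refine ha (h.mem_of_prod_pow_mul_mem (t := t) ?_)
    rw [hsup] at hmem
    obtain ⟨b, hb, v, hv, hbv⟩ := Submodule.mem_sup.mp hmem
    obtain ⟨c, rfl⟩ := Ideal.mem_span_singleton'.mp hb
    rw [← hbv, add_mul]
    refine add_mem ?_ (Ideal.mul_mem_right _ _ hv)
    rw [mul_assoc]
    exact Ideal.mul_mem_left _ _ (le_sup_right (b := Ideal.ofList ys) hla)

end MonomialConjectureIff

/-! ### Canonical modules as kernels of multiplication by `l`. -/

section CanonicalModuleKer

open IsLocalRing RingTheory.Sequence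

variable {A : Type u} [CommRing A]

/-- Linear maps from a cyclic module are the elements killed by its annihilator. -/
theorem nonempty_Hom_quotient_equiv_ker (I : Ideal A) (l : A) :
    Nonempty (((A ⧸ (Ideal.span {l} ⊔ I)) →ₗ[A] (A ⧸ I)) ≃ₗ[A]
      LinearMap.ker (LinearMap.lsmul A (A ⧸ I) l)) := by
  set φ : ((A ⧸ (Ideal.span {l} ⊔ I)) →ₗ[A] (A ⧸ I)) →ₗ[A]
      LinearMap.ker (LinearMap.lsmul A (A ⧸ I) l) :=
    LinearMap.codRestrict _
      (LinearMap.applyₗ (R := A) (M₂ := A ⧸ I) (1 : A ⧸ (Ideal.span {l} ⊔ I))) (fun f => by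
        change l • f 1 = 0
        have h1 : l • (1 : A ⧸ (Ideal.span {l} ⊔ I)) = 0 := by
          rw [Algebra.smul_def, mul_one]
          exact Ideal.Quotient.eq_zero_iff_mem.mpr
            (le_sup_left (b := I) (Ideal.mem_span_singleton_self l))
        rw [← map_smul, h1, map_zero]) with hφ
  refine ⟨LinearEquiv.ofBijective φ ⟨?_, ?_⟩⟩
  · intro f g hfg
    refine LinearMap.ext fun t => ?_
    obtain ⟨a, rfl⟩ := Ideal.Quotient.mk_surjective t
    have h1 : Ideal.Quotient.mk (Ideal.span {l} ⊔ I) a =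
        a • (1 : A ⧸ (Ideal.span {l} ⊔ I)) := by
      rw [Algebra.smul_def, mul_one]
      rfl
    rw [h1, map_smul, map_smul]
    exact congrArg (a • ·) (congrArg Subtype.val hfg)
  · rintro ⟨v, hv⟩
    have hv' : l • v = 0 := hv
    have hle : (Ideal.span {l} ⊔ I : Ideal A) ≤ LinearMap.ker (LinearMap.toSpanSingleton A _ v) := by
      refine sup_le ((Ideal.span_singleton_le_iff_mem _).mpr hv') fun a ha => ?_
      obtain ⟨w, rfl⟩ := Ideal.Quotient.mk_surjective v
      change a • Ideal.Quotient.mk I w = 0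
      rw [Algebra.smul_def, Ideal.Quotient.algebraMap_eq, Ideal.Quotient.eq_zero_iff_mem.mpr ha,
        zero_mul]
    refine ⟨Submodule.liftQ _ (LinearMap.toSpanSingleton A _ v) hle, Subtype.ext ?_⟩
    exact one_smul A v

/-- The codimension equals the length of `zs`, so Rees gives `Hom(A/I, A/(zs))`; a map from this
cyclic module is an element killed by `l`. It serves both `R` and `R/𝔞`. -/
theorem nonempty_canonicalModule_equiv_ker {I : Ideal A} {l : A} {zs : List A}
    (hI : I = Ideal.span {l} ⊔ Ideal.ofList zs) (hz : IsWeaklyRegular A zs)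
    (hc : quotientCodim I = zs.length) :
    Nonempty (CanonicalModule I ≃ₗ[A]
      LinearMap.ker (LinearMap.lsmul A (A ⧸ Ideal.ofList zs) l)) := by
  obtain ⟨e⟩ := nonempty_Ext_equiv_of_isWeaklyRegular
    (M := ModuleCat.of A (A ⧸ I)) (N := ModuleCat.of A A) (rs := zs)
    (fun z hz => by
      rw [Ideal.annihilator_quotient, hI]
      exact le_sup_right (a := Ideal.span {l}) (Ideal.subset_span hz)) hz
  obtain ⟨e'⟩ := nonempty_Hom_quotient_equiv_ker (Ideal.ofList zs) l
  rw [← hc] at e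
  have htop : (Ideal.ofList zs • ⊤ : Submodule A A) = Ideal.ofList zs := by simp
  have e2 : ((A ⧸ I) →ₗ[A] (A ⧸ Ideal.ofList zs)) ≃ₗ[A]
      ((A ⧸ (Ideal.span {l} ⊔ Ideal.ofList zs)) →ₗ[A] (A ⧸ Ideal.ofList zs)) :=
    LinearEquiv.congrLeft _ A (Submodule.quotEquivOfEq _ _ hI)
  exact ⟨e.trans ((LinearEquiv.congrRight (Submodule.quotEquivOfEq _ _ htop)).trans
    (e2.trans e'))⟩

theorem nonempty_ker_lsmul_equiv {M N : Type*} [AddCommGroup M] [Module A M] [AddCommGroup N]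
    [Module A N] (e : M ≃ₗ[A] N) (l : A) :
    Nonempty (LinearMap.ker (LinearMap.lsmul A M l) ≃ₗ[A]
      LinearMap.ker (LinearMap.lsmul A N l)) := by
  refine ⟨e.ofSubmodules _ _ ?_⟩
  ext v
  constructor
  · rintro ⟨w, hw, rfl⟩
    change l • e w = 0
    rw [← map_smul, show l • w = 0 from hw, map_zero]
  · intro hv
    refine ⟨e.symm v, ?_, e.apply_symm_apply v⟩
    change l • e.symm v = 0
    rw [← map_smul, show l • v = 0 from hv, map_zero]

theorem map_mkQ_eq_smul_top (J X : Ideal A) :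
    Submodule.map J.mkQ X = (X • ⊤ : Submodule A (A ⧸ J)) := by
  have h : X = (X • ⊤ : Submodule A A) := by simp
  rw [h, Submodule.map_smul'', Submodule.map_top, Submodule.range_mkQ, ← h]

theorem mk_mem_smul_top_iff {J X : Ideal A} {a : A} :
    (Submodule.Quotient.mk a : A ⧸ J) ∈ (X • ⊤ : Submodule A (A ⧸ J)) ↔ a ∈ X ⊔ J := by
  rw [← map_mkQ_eq_smul_top]
  change J.mkQ a ∈ _ ↔ _
  rw [← Submodule.mem_comap, Submodule.comap_map_mkQ, sup_comm]

theorem nonempty_quotient_smul_top_equiv (J X : Ideal A) :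
    Nonempty (((A ⧸ J) ⧸ (X • ⊤ : Submodule A (A ⧸ J))) ≃ₗ[A] (A ⧸ (X ⊔ J))) :=
  ⟨(Submodule.quotEquivOfEq _ _ (map_mkQ_eq_smul_top J X).symm).trans
    ((Submodule.quotientQuotientEquivQuotientSup J X).trans
      (Submodule.quotEquivOfEq _ _ (sup_comm _ _)))⟩

end CanonicalModuleKer

/-! ### The depth shift and the length criterion. -/

section DepthShift

open IsLocalRing

variable {A : Type*} [CommRing A] [IsLocalRing A] [IsNoetherianRing A] {d : ℕ} {x : Fin d → A}

/-- Depth is `d` minus the top degree of nonzero Koszul homology, and the hypothesis lowers degrees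
by two. Degree `0` of `N` is never acyclic, which caps the depth of `N` at `d`. -/
theorem moduleDepth_eq_of_koszulAcyclic_shift
    (M N : Type*) [AddCommGroup M] [Module A M] [Module.Finite A M] [Nontrivial M]
    [AddCommGroup N] [Module A N] [Module.Finite A N] [Nontrivial N]
    (hx : ∀ j, x j ∈ maximalIdeal A)
    (hM : maximalIdeal A ≤ (Ideal.span (Set.range x) ⊔ Module.annihilator A M).radical)
    (hN : maximalIdeal A ≤ (Ideal.span (Set.range x) ⊔ Module.annihilator A N).radical)
    (h : ∀ i, i ≠ 0 → (KoszulAcyclic x M (i + 2) ↔ KoszulAcyclic x N i)) :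
    (moduleDepth A M + 2 ≤ d → moduleDepth A N = moduleDepth A M + 2) ∧
      ((d : ℕ∞) ≤ moduleDepth A M + 1 → moduleDepth A N = d) := by
  have hM' := natCast_le_moduleDepth_iff_koszulAcyclic M hx hM
  have hN' := natCast_le_moduleDepth_iff_koszulAcyclic N hx hN
  have hN0 : ∀ k : ℕ, (k : ℕ∞) ≤ moduleDepth A N → k ≤ d := by
    intro k hk
    by_contra hkd
    exact not_koszulAcyclic_zero N hx ((hN' k).mp hk 0 (by omega))
  constructor
  · intro hle
    have hfin : moduleDepth A M ≠ ⊤ := by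
      intro htop
      rw [htop, top_add] at hle
      exact absurd hle (by simp)
    obtain ⟨r, hr⟩ := ENat.ne_top_iff_exists.mp hfin
    rw [← hr] at hle hM' ⊢
    have hrd : r + 2 ≤ d := by exact_mod_cast hle
    refine ENat.eq_of_forall_natCast_le_iff fun k => ?_
    have hk2 : ((k : ℕ∞) ≤ (r : ℕ∞) + 2) ↔ k ≤ r + 2 := by exact_mod_cast Iff.rfl
    rw [hk2]
    constructor
    · intro hk
      by_contra hkr
      -- From `r + 3 ≤ k ≤ d` the degrees needed for `M` are at least `3`, so the shifted degree `j`
      -- is nonzero and `h` applies.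
      have hkd := hN0 k hk
      have h1 : ((r + 1 : ℕ) : ℕ∞) ≤ r := (hM' (r + 1)).mpr fun i hi => by
        obtain ⟨j, rfl⟩ : ∃ j, i = j + 2 := ⟨i - 2, by omega⟩
        exact (h j (by omega)).mpr ((hN' k).mp hk j (by omega))
      have h2 : r + 1 ≤ r := by exact_mod_cast h1
      omega
    · intro hk
      exact (hN' k).mpr fun i hi =>
        (h i (by omega)).mp ((hM' r).mp le_rfl (i + 2) (by omega))
  · intro hle
    have h1 : ((d - 1 : ℕ) : ℕ∞) ≤ moduleDepth A M := by
      rcases d with _ | d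
      · simp
      · have h2 : ((d : ℕ∞) + 1) ≤ moduleDepth A M + 1 := by exact_mod_cast hle
        simpa using (ENat.add_le_add_iff_right ENat.one_ne_top).mp h2
    refine ENat.eq_of_forall_natCast_le_iff fun k => ⟨fun hk => by exact_mod_cast hN0 k hk,
      fun hk => ?_⟩
    have hk' : k ≤ d := by exact_mod_cast hk
    exact (hN' k).mpr fun i hi =>
      (h i (by omega)).mp ((hM' (d - 1)).mp h1 (i + 2) (by omega))

end DepthShift

section LengthExact

theorem length_lt_iff_ne_zero_of_exact {A : Type*} [CommRing A] {M N P : Type*} [AddCommGroup M]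
    [Module A M] [AddCommGroup N] [Module A N] [AddCommGroup P] [Module A P]
    (hN : IsFiniteLength A N) {f : M →ₗ[A] N} {g : N →ₗ[A] P} (hf : Function.Injective f)
    (hfg : Function.Exact f g) : Module.length A M < Module.length A N ↔ g ≠ 0 := by
  have hnA := isFiniteLength_iff_isNoetherian_isArtinian.mp hN
  have := hnA.1
  have := hnA.2
  constructor
  · rintro hlt rfl
    have hs : Function.Surjective f := fun v => (hfg v).mp rfl
    exact hlt.ne (LinearEquiv.ofBijective f ⟨hf, hs⟩).length_eq
  · intro hg
    rw [(LinearEquiv.ofInjective f hf).length_eq]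
    refine Submodule.length_lt fun htop => hg (LinearMap.ext fun v => ?_)
    have hv : v ∈ LinearMap.range f := by
      rw [htop]
      trivial
    exact (hfg v).mpr hv

end LengthExact

/-! ### Dimension of the almost complete intersection, and assembly of the comparison. -/

section AlmostCompleteIntersection

open IsLocalRing RingTheory.Sequence

variable {A : Type u} [CommRing A] {d n : ℕ}

theorem ofList_ofFn (x : Fin d → A) : Ideal.ofList (List.ofFn x) = Ideal.span (Set.range x) := by
  rw [Ideal.ofList]
  congr 1
  ext v
  exact List.mem_ofFn' x v

theorem span_range_eq_span_last_sup (y : Fin (n + 1) → A) :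
    Ideal.span (Set.range y) =
      Ideal.span {y (Fin.last n)} ⊔ Ideal.ofList (List.ofFn (Fin.init y)) := by
  rw [ofList_ofFn]
  refine le_antisymm (Ideal.span_le.mpr ?_) (sup_le ?_ ?_)
  · rintro _ ⟨i, rfl⟩
    refine Fin.lastCases ?_ (fun j => ?_) i
    · exact le_sup_left (b := Ideal.span (Set.range (Fin.init y)))
        (Ideal.mem_span_singleton_self _)
    · exact le_sup_right (a := Ideal.span {y (Fin.last n)}) (Ideal.subset_span ⟨j, rfl⟩)
  · exact (Ideal.span_singleton_le_iff_mem _).mpr (Ideal.subset_span ⟨_, rfl⟩)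
  · refine Ideal.span_mono ?_
    rintro _ ⟨j, rfl⟩
    exact ⟨j.castSucc, rfl⟩

theorem mem_maximalIdeal_of_isRegular [IsLocalRing A] {zs : List A} (h : IsRegular A zs) :
    ∀ z ∈ zs, z ∈ maximalIdeal A := by
  have hne : Ideal.ofList zs ≠ ⊤ := fun htop => h.top_ne_smul (by rw [htop]; simp)
  exact fun z hz => le_maximalIdeal hne (Ideal.subset_span hz)

theorem maximalIdeal_le_radical_of_ringKrullDim_eq_zero [IsLocalRing A] {I : Ideal A}
    (h : ringKrullDim (A ⧸ I) = 0) : maximalIdeal A ≤ I.radical := by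
  have h0 : Ring.KrullDimLE 0 (A ⧸ I) := Ring.krullDimLE_iff.mpr h.le
  rw [Ideal.radical_eq_sInf]
  refine le_sInf fun p hp => ?_
  have := hp.2
  have hpp := Ideal.map_isPrime_of_surjective (f := Ideal.Quotient.mk I)
    Ideal.Quotient.mk_surjective (I := p) (by rw [Ideal.mk_ker]; exact hp.1)
  have hmax := Ring.krullDimLE_zero_iff.mp h0 _ hpp
  have hcm := Ideal.comap_isMaximal_of_surjective (Ideal.Quotient.mk I)
    Ideal.Quotient.mk_surjective (K := p.map (Ideal.Quotient.mk I))
  rw [Ideal.comap_map_of_surjective' _ Ideal.Quotient.mk_surjective, Ideal.mk_ker,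
    sup_eq_left.mpr hp.1] at hcm
  exact (eq_maximalIdeal hcm).ge

theorem IsParameterSystem.of_isRegular [IsLocalRing A] [IsNoetherianRing A] {x : Fin d → A}
    {ys : List A} (h : IsRegular A (List.ofFn x ++ ys))
    (hdim : ringKrullDim A = ((d + ys.length : ℕ) : WithBot ℕ∞)) :
    IsParameterSystem x ys ∧
      ringKrullDim (A ⧸ (Ideal.span (Set.range x) ⊔ Ideal.ofList ys)) = 0 := by
  have hm := mem_maximalIdeal_of_isRegular h
  have hl : (List.ofFn x ++ ys).length = d + ys.length := by simp
  have hspan : Ideal.ofList (List.ofFn x ++ ys) =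
      Ideal.span (Set.range x) ⊔ Ideal.ofList ys := by
    rw [Ideal.ofList_append, ofList_ofFn]
  have hd := ringKrullDim_add_length_eq_ringKrullDim_of_isRegular _ h
  rw [hl, hdim, hspan] at hd
  have h0 : ringKrullDim (A ⧸ (Ideal.span (Set.range x) ⊔ Ideal.ofList ys)) = 0 := by
    generalize ringKrullDim (A ⧸ (Ideal.span (Set.range x) ⊔ Ideal.ofList ys)) = D at hd
    induction D with
    | bot => exact absurd hd (WithBot.bot_ne_coe (a := ((d + ys.length : ℕ) : ℕ∞)))
    | coe D =>
      have hd' : D + ((d + ys.length : ℕ) : ℕ∞) = 0 + ((d + ys.length : ℕ) : ℕ∞) := by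
        rw [zero_add]
        exact_mod_cast hd
      have := (ENat.add_le_add_iff_right (ENat.natCast_ne_top _)).mp hd'.le
      rw [nonpos_iff_eq_zero.mp this]
      rfl
  refine ⟨⟨fun i => hm _ (List.mem_append_left _ (by simp)),
    fun y hy => hm _ (List.mem_append_right _ hy), ?_, ?_⟩, h0⟩
  · exact (natCast_le_moduleDepth_iff_exists A).mpr ⟨_, hm, h, hl.ge⟩
  · exact maximalIdeal_le_radical_of_ringKrullDim_eq_zero h0

/-- Otherwise `ys, l` would be a regular sequence longer than the height of the ideal containing it.
-/
theorem not_isSMulRegular_of_height_le [IsNoetherianRing A] {ys : List A} {l : A}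
    (hy : IsWeaklyRegular A ys)
    (hht : (Ideal.span {l} ⊔ Ideal.ofList ys).height ≤ ys.length) :
    ¬ IsSMulRegular (A ⧸ Ideal.ofList ys) l := by
  intro hl
  have h1 : IsWeaklyRegular A (ys ++ [l]) := by
    rw [isWeaklyRegular_append_iff, isWeaklyRegular_singleton_iff]
    exact ⟨hy, ((Submodule.quotEquivOfEq (Ideal.ofList ys • (⊤ : Submodule A A)) (Ideal.ofList ys)
      (by simp)).isSMulRegular_congr l).mpr hl⟩
  have h2 := length_le_height_of_isWeaklyRegular (I := Ideal.span {l} ⊔ Ideal.ofList ys) (by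
    intro r hr
    rcases List.mem_append.mp hr with hr | hr
    · exact le_sup_right (a := Ideal.span {l}) (Ideal.subset_span hr)
    · rw [List.mem_singleton.mp hr]
      exact le_sup_left (b := Ideal.ofList ys) (Ideal.mem_span_singleton_self l)) h1
  have h3 := h2.trans hht
  rw [List.length_append] at h3
  have h4 : ys.length + [l].length ≤ ys.length := by exact_mod_cast h3
  simp at h4

/-- The dimension of the almost complete intersection `A / (l, ys)`. -/
theorem IsParameterSystem.ringKrullDim_quotient_eq [IsLocalRing A] [IsNoetherianRing A]
    {x : Fin d → A} {ys : List A} (h : IsParameterSystem x ys) {l : A}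
    (hx : IsWeaklyRegular (A ⧸ Ideal.ofList ys) (List.ofFn x))
    (hl : ¬ IsSMulRegular (A ⧸ Ideal.ofList ys) l) :
    ringKrullDim (A ⧸ (Ideal.span {l} ⊔ Ideal.ofList ys)) = d := by
  have hxm : ∀ z ∈ List.ofFn x, z ∈ maximalIdeal A := by
    intro z hz
    obtain ⟨i, rfl⟩ := (List.mem_ofFn' x z).mp hz
    exact h.mem_x i
  have h2 : l ∈ ⋃ p ∈ associatedPrimes A (A ⧸ Ideal.ofList ys), (p : Set A) := by
    rw [biUnion_associatedPrimes_eq_compl_regular]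
    exact hl
  -- The zero divisor `l` lies in an associated prime `p` of `A/(ys)`. As `x` is regular on
  -- `A/(ys)`, `dim A/p ≥ d`, and `A/p` is a quotient of `A/(l, ys)`; the upper bound holds because
  -- `x` is primary there.
  obtain ⟨p, hp, hlp⟩ := Set.mem_iUnion₂.mp h2
  have hle : Ideal.span {l} ⊔ Ideal.ofList ys ≤ p := by
    refine sup_le ((Ideal.span_singleton_le_iff_mem _).mpr hlp) ?_
    have := IsAssociatedPrime.annihilator_le hp
    rwa [Submodule.annihilator_top, Ideal.annihilator_quotient] at this
  have hne : Ideal.span {l} ⊔ Ideal.ofList ys ≠ ⊤ := fun htop =>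
    (IsAssociatedPrime.isPrime hp).ne_top (top_le_iff.mp (htop ▸ hle))
  refine le_antisymm ?_ ?_
  · have h3 := ringKrullDim_quotient_le_length hxm hne (h.le_radical.trans (Ideal.radical_mono (by
      rw [ofList_ofFn]
      exact sup_le_sup_left le_sup_right _)))
    simpa using h3
  · have h3 := length_le_ringKrullDim_quotient_of_isWeaklyRegular hp hxm hx
    rw [List.length_ofFn] at h3
    exact h3.trans (ringKrullDim_le_of_surjective (Ideal.Quotient.factor hle)
      (Ideal.Quotient.factor_surjective hle))

theorem isSystemOfParameters_mk [IsLocalRing A] {x : Fin d → A} {I : Ideal A}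
    (hx : ∀ i, x i ∈ maximalIdeal A) (hI : I ≠ ⊤) (hdim : ringKrullDim (A ⧸ I) = d)
    (hrad : maximalIdeal A ≤ (Ideal.span (Set.range x) ⊔ I).radical) :
    IsSystemOfParameters (fun i => Ideal.Quotient.mk I (x i)) := by
  have := Ideal.Quotient.nontrivial_iff.mpr hI
  have hloc : IsLocalRing (A ⧸ I) :=
    IsLocalRing.of_surjective' (Ideal.Quotient.mk I) Ideal.Quotient.mk_surjective
  have hlh : IsLocalHom (Ideal.Quotient.mk I) :=
    IsLocalHom.of_surjective _ Ideal.Quotient.mk_surjective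
  refine ⟨hdim, hloc, le_antisymm ?_ ?_⟩
  · rw [(maximalIdeal.isMaximal (A ⧸ I)).isPrime.radical_le_iff, Ideal.span_le]
    rintro _ ⟨i, rfl⟩
    exact (map_mem_nonunits_iff (Ideal.Quotient.mk I) (x i)).mpr (hx i)
  · intro b hb
    obtain ⟨a, rfl⟩ := Ideal.Quotient.mk_surjective b
    obtain ⟨m, hm⟩ := hrad ((map_mem_nonunits_iff (Ideal.Quotient.mk I) a).mp hb)
    refine ⟨m, ?_⟩
    have h1 := Ideal.mem_map_of_mem (Ideal.Quotient.mk I) hm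
    rw [Ideal.map_sup, Ideal.map_quotient_self, sup_bot_eq, Ideal.map_span, ← Set.range_comp,
      map_pow] at h1
    exact h1

theorem quotientCodim_eq {I : Ideal A} {a b : ℕ} (hA : ringKrullDim A = ((a + b : ℕ) : WithBot ℕ∞))
    (hI : ringKrullDim (A ⧸ I) = a) : quotientCodim I = b := by
  have h1 : (ringKrullDim A).unbotD 0 = ((a + b : ℕ) : ℕ∞) := by rw [hA]; rfl
  have h2 : (ringKrullDim (A ⧸ I)).unbotD 0 = (a : ℕ∞) := by rw [hI]; rfl
  rw [quotientCodim, h1, h2, ← ENat.natCast_sub, ENat.toNat_natCast]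
  omega

/-- The comparison of `A / 𝔟` with `W = ker (l : S → S)` and `W' = ker (l : S / 𝔞 S → S / 𝔞 S)`, for
`S = A / (ys)` and `𝔟 = (l, ys)`. -/
theorem IsParameterSystem.koszul_comparison [IsRegularLocalRing A] {x : Fin d → A} {ys : List A}
    (hps : IsParameterSystem x ys) {l : A} {𝔟 : Ideal A}
    (hdim : ringKrullDim A = ((d + ys.length : ℕ) : WithBot ℕ∞))
    (h𝔟 : 𝔟 = Ideal.span {l} ⊔ Ideal.ofList ys) (h𝔟top : 𝔟 ≠ ⊤)
    (hxreg : IsWeaklyRegular (A ⧸ Ideal.ofList ys) (List.ofFn x))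
    (hlreg : ¬ IsSMulRegular (A ⧸ Ideal.ofList ys) l)
    {W W' : Type*} [AddCommGroup W] [Module A W] [AddCommGroup W'] [Module A W']
    (e : W ≃ₗ[A] LinearMap.ker (LinearMap.lsmul A (A ⧸ Ideal.ofList ys) l))
    (e' : W' ≃ₗ[A] LinearMap.ker (LinearMap.lsmul A (A ⧸ Ideal.ofList (List.ofFn x ++ ys)) l)) :
    (∃ (f : KoszulHomology x (A ⧸ 𝔟) 2 →ₗ[A] W ⧸ (Ideal.span (Set.range x) • ⊤ : Submodule A W))
        (g : (W ⧸ (Ideal.span (Set.range x) • ⊤ : Submodule A W)) →ₗ[A] W')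
        (h : W' →ₗ[A] KoszulHomology x (A ⧸ 𝔟) 1),
        Function.Injective f ∧ Function.Exact f g ∧ Function.Exact g h ∧
          Function.Surjective h) ∧
    (∀ i : ℕ, 3 ≤ i → Nonempty
        (KoszulHomology x (A ⧸ 𝔟) i ≃ₗ[A] KoszulHomology x W (i - 2))) ∧
    (moduleDepth A (A ⧸ 𝔟) + 2 ≤ d → moduleDepth A W = moduleDepth A (A ⧸ 𝔟) + 2) ∧
    ((d : ℕ∞) ≤ moduleDepth A (A ⧸ 𝔟) + 1 → moduleDepth A W = d) ∧
    IsSystemOfParameters (fun i => Ideal.Quotient.mk 𝔟 (x i)) ∧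
    (SatisfiesMonomialConjecture (fun i => Ideal.Quotient.mk 𝔟 (x i)) ↔
        Module.length A (KoszulHomology x (A ⧸ 𝔟) 2) <
          Module.length A (W ⧸ (Ideal.span (Set.range x) • ⊤ : Submodule A W))) ∧
    (∀ (f : KoszulHomology x (A ⧸ 𝔟) 2 →ₗ[A] W ⧸ (Ideal.span (Set.range x) • ⊤ : Submodule A W))
        (g : (W ⧸ (Ideal.span (Set.range x) • ⊤ : Submodule A W)) →ₗ[A] W')
        (h : W' →ₗ[A] KoszulHomology x (A ⧸ 𝔟) 1),
        Function.Injective f → Function.Exact f g → Function.Exact g h →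
          Function.Surjective h →
        (SatisfiesMonomialConjecture (fun i => Ideal.Quotient.mk 𝔟 (x i)) ↔ g ≠ 0)) := by
  have := Ideal.Quotient.nontrivial_iff.mpr h𝔟top
  have hdimR : ringKrullDim (A ⧸ 𝔟) = d := by
    rw [h𝔟]
    exact hps.ringKrullDim_quotient_eq hxreg hlreg
  set X := Ideal.span (Set.range x) with hX
  have hysle : Ideal.ofList ys ≤ 𝔟 := h𝔟 ▸ le_sup_right
  have hrad : maximalIdeal A ≤ (X ⊔ 𝔟).radical :=
    hps.le_radical.trans (Ideal.radical_mono (sup_le_sup_left hysle _))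
  obtain ⟨eS⟩ := nonempty_quotient_smul_top_equiv (Ideal.ofList ys) X
  obtain ⟨eK⟩ := nonempty_ker_lsmul_equiv (eS.trans (Submodule.quotEquivOfEq _ _
    (by rw [Ideal.ofList_append, ofList_ofFn] :
      X ⊔ Ideal.ofList ys = Ideal.ofList (List.ofFn x ++ ys)))) l
  -- the exact sequence `0 → ω → S → S → R → 0`
  set ι : W →ₗ[A] (A ⧸ Ideal.ofList ys) :=
    (LinearMap.ker (LinearMap.lsmul A (A ⧸ Ideal.ofList ys) l)).subtype ∘ₗ e.toLinearMap with hι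
  have hιi : Function.Injective ι := Subtype.val_injective.comp e.injective
  have hιl : Function.Exact ι (LinearMap.lsmul A (A ⧸ Ideal.ofList ys) l) := by
    intro v
    constructor
    · intro hv
      exact ⟨e.symm ⟨v, hv⟩, congrArg Subtype.val (e.apply_symm_apply ⟨v, hv⟩)⟩
    · rintro ⟨w, rfl⟩
      exact (e w).2
  set π : (A ⧸ Ideal.ofList ys) →ₗ[A] (A ⧸ 𝔟) := Submodule.factor hysle with hπ
  have hπs : Function.Surjective π := Submodule.factor_surjective hysle
  have hlπ : Function.Exact (LinearMap.lsmul A (A ⧸ Ideal.ofList ys) l) π := by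
    intro v
    obtain ⟨a, rfl⟩ := Submodule.Quotient.mk_surjective _ v
    change (Submodule.Quotient.mk a : A ⧸ 𝔟) = 0 ↔ _
    rw [Submodule.Quotient.mk_eq_zero]
    constructor
    · intro ha
      rw [h𝔟] at ha
      obtain ⟨b, hb, v, hv, rfl⟩ := Submodule.mem_sup.mp ha
      obtain ⟨c, rfl⟩ := Ideal.mem_span_singleton'.mp hb
      refine ⟨Submodule.Quotient.mk c, ?_⟩
      rw [LinearMap.lsmul_apply, ← Submodule.Quotient.mk_smul, Submodule.Quotient.eq, smul_eq_mul,
        mul_comm, sub_add_cancel_left]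
      exact neg_mem hv
    · rintro ⟨w, hw⟩
      obtain ⟨c, rfl⟩ := Submodule.Quotient.mk_surjective _ w
      rw [LinearMap.lsmul_apply, ← Submodule.Quotient.mk_smul, Submodule.Quotient.eq,
        smul_eq_mul] at hw
      have h1 : l * c ∈ 𝔟 := by
        rw [h𝔟]
        exact Ideal.mul_mem_right _ _
          (le_sup_left (b := Ideal.ofList ys) (Ideal.mem_span_singleton_self l))
      have h2 := sub_mem h1 (hysle hw)
      rwa [sub_sub_cancel] at h2
  have hacyc : ∀ p, p ≠ 0 → KoszulAcyclic x (A ⧸ Ideal.ofList ys) p := fun p hp =>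
    KoszulAcyclic.of_isWeaklyRegular x _ hxreg hp
  obtain ⟨f, g, h, hf, hfg, hgh, hh, hgι⟩ :=
    exists_koszul_four_term_exact x hιi hιl hlπ hπs hacyc
  -- finiteness of the canonical module
  have hωfin : Module.Finite A W := Module.Finite.equiv e.symm
  -- `W` is the annihilator of the zero divisor `l`.
  have hωnt : Nontrivial W := by
    by_contra hnt
    rw [not_nontrivial_iff_subsingleton] at hnt
    refine hlreg (IsSMulRegular.of_right_eq_zero_of_smul fun v hv => ?_)
    obtain ⟨w, rfl⟩ := (hιl v).mp hv
    rw [Subsingleton.elim w 0, map_zero]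
  have hωann : 𝔟 ≤ Module.annihilator A W := by
    intro b hb
    rw [Module.mem_annihilator]
    intro w
    refine hιi ?_
    rw [map_smul, map_zero]
    obtain ⟨a, ha⟩ := Submodule.Quotient.mk_surjective _ (ι w)
    have hla : l • ι w = 0 := (hιl (ι w)).mpr ⟨w, rfl⟩
    rw [← ha, ← Submodule.Quotient.mk_smul, Submodule.Quotient.mk_eq_zero, smul_eq_mul] at hla
    rw [h𝔟] at hb
    obtain ⟨c, hc, v, hv, rfl⟩ := Submodule.mem_sup.mp hb
    obtain ⟨c, rfl⟩ := Ideal.mem_span_singleton'.mp hc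
    rw [← ha, ← Submodule.Quotient.mk_smul, Submodule.Quotient.mk_eq_zero, smul_eq_mul, add_mul,
      mul_assoc]
    exact add_mem (Ideal.mul_mem_left _ _ hla) (Ideal.mul_mem_right _ _ hv)
  have hωfl : IsFiniteLength A
      (W ⧸ (X • ⊤ : Submodule A W)) := by
    refine isFiniteLength_of_le_radical_annihilator (hrad.trans (Ideal.radical_mono ?_))
    refine sup_le (fun a ha => ?_) (hωann.trans
      (LinearMap.annihilator_le_of_surjective (Submodule.mkQ _) (Submodule.mkQ_surjective _)))
    rw [Module.mem_annihilator]
    intro v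
    obtain ⟨w, rfl⟩ := Submodule.Quotient.mk_surjective _ v
    rw [← Submodule.Quotient.mk_smul, Submodule.Quotient.mk_eq_zero]
    exact Submodule.smul_mem_smul ha trivial
  have hMC : SatisfiesMonomialConjecture (fun i => Ideal.Quotient.mk 𝔟 (x i)) ↔ g ≠ 0 := by
    have h1 := hps.satisfiesMonomialConjecture_iff hdim l
    rw [← h𝔟] at h1
    rw [h1]
    constructor
    · rintro ⟨a, hla, haQ⟩ rfl
      have h2 : LinearMap.lsmul A (A ⧸ Ideal.ofList ys) l (Submodule.Quotient.mk a) = 0 := by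
        rw [LinearMap.lsmul_apply, ← Submodule.Quotient.mk_smul, Submodule.Quotient.mk_eq_zero]
        exact hla
      obtain ⟨w, hw⟩ := (hιl _).mp h2
      refine haQ (mk_mem_smul_top_iff.mp ?_)
      rw [← hw, ← Submodule.Quotient.mk_eq_zero, ← hgι w]
      rfl
    · intro hg0
      by_contra! hcon
      refine hg0 (LinearMap.ext fun v => ?_)
      obtain ⟨w, rfl⟩ := Submodule.Quotient.mk_surjective _ v
      refine Subtype.ext ?_
      rw [hgι]
      obtain ⟨a, ha⟩ := Submodule.Quotient.mk_surjective _ (ι w)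
      have hla : l • ι w = 0 := (hιl (ι w)).mpr ⟨w, rfl⟩
      rw [← ha, ← Submodule.Quotient.mk_smul, Submodule.Quotient.mk_eq_zero, smul_eq_mul] at hla
      rw [← ha]
      exact (Submodule.Quotient.mk_eq_zero _).mpr (mk_mem_smul_top_iff.mpr (hcon a hla))
  -- The length inequality does not mention `g`, so it transfers the criterion from the constructed
  -- map to the middle map of any such exact sequence.
  have hMClen := hMC.trans (length_lt_iff_ne_zero_of_exact hωfl hf hfg).symm
  have hdepth := moduleDepth_eq_of_koszulAcyclic_shift (x := x) (A ⧸ 𝔟) W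
    hps.mem_x (by rwa [Ideal.annihilator_quotient])
    (hrad.trans (Ideal.radical_mono (sup_le_sup_left hωann _))) fun i hi => by
      obtain ⟨ei⟩ := nonempty_koszulHomology_equiv x hιi hιl hlπ hπs hacyc i hi
      rw [koszulAcyclic_iff_subsingleton, koszulAcyclic_iff_subsingleton]
      exact ei.toEquiv.subsingleton_congr
  refine ⟨?_, fun i hi => ?_, hdepth.1, hdepth.2,
    isSystemOfParameters_mk hps.mem_x h𝔟top hdimR hrad, hMClen,
    fun f' g' h' hf' hfg' _ _ => hMClen.trans (length_lt_iff_ne_zero_of_exact hωfl hf' hfg')⟩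
  · set ε := eK.trans e'.symm with hε
    refine ⟨f, ε.toLinearMap ∘ₗ g, h ∘ₗ ε.symm.toLinearMap, hf, ?_, ?_,
      hh.comp ε.symm.surjective⟩
    · intro v
      rw [← hfg v]
      exact ε.map_eq_zero_iff
    · intro v
      obtain ⟨w, rfl⟩ := ε.surjective v
      have h1 := hgh w
      rw [LinearMap.comp_apply, LinearEquiv.coe_coe, ε.symm_apply_apply, h1]
      constructor
      · rintro ⟨t, rfl⟩
        exact ⟨t, rfl⟩
      · rintro ⟨t, ht⟩
        exact ⟨t, ε.injective ht⟩
  · obtain ⟨j, rfl⟩ : ∃ j, i = j + 2 := ⟨i - 2, by omega⟩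
    exact nonempty_koszulHomology_equiv x hιi hιl hlπ hπs hacyc j (by omega)

end AlmostCompleteIntersection

/-! ### The main theorem. -/

theorem lemma4p1 {A : Type u} [CommRing A] [IsRegularLocalRing A] {d n : ℕ}
    (x : Fin d → A) (y : Fin (n + 1) → A) (𝔞 𝔟 : Ideal A)
    (h𝔞 : 𝔞 = Ideal.span (Set.range x)) (h𝔟 : 𝔟 = Ideal.span (Set.range y))
    (hht𝔞 : 𝔞.height = d) (hht𝔟 : 𝔟.height = n)
    (hreg : RingTheory.Sequence.IsRegular A (List.ofFn x ++ List.ofFn (Fin.init y)))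
    (hdim : ringKrullDim A = ((d + n : ℕ) : WithBot ℕ∞)) :
    -- (i)
    (∃ (f : KoszulHomology x (A ⧸ 𝔟) 2 →ₗ[A]
            CanonicalModule 𝔟 ⧸ (𝔞 • ⊤ : Submodule A (CanonicalModule 𝔟)))
        (g : (CanonicalModule 𝔟 ⧸ (𝔞 • ⊤ : Submodule A (CanonicalModule 𝔟))) →ₗ[A]
            CanonicalModule (𝔟 ⊔ 𝔞))
        (h : CanonicalModule (𝔟 ⊔ 𝔞) →ₗ[A] KoszulHomology x (A ⧸ 𝔟) 1),
        Function.Injective f ∧ Function.Exact f g ∧ Function.Exact g h ∧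
          Function.Surjective h) ∧
    -- (ii)
    (∀ i : ℕ, 3 ≤ i → Nonempty
        (KoszulHomology x (A ⧸ 𝔟) i ≃ₗ[A] KoszulHomology x (CanonicalModule 𝔟) (i - 2))) ∧
    (moduleDepth A (A ⧸ 𝔟) + 2 ≤ d →
        moduleDepth A (CanonicalModule 𝔟) = moduleDepth A (A ⧸ 𝔟) + 2) ∧
    ((d : ℕ∞) ≤ moduleDepth A (A ⧸ 𝔟) + 1 → moduleDepth A (CanonicalModule 𝔟) = d) ∧
    -- (iii)
    IsSystemOfParameters (fun i => Ideal.Quotient.mk 𝔟 (x i)) ∧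
    (SatisfiesMonomialConjecture (fun i => Ideal.Quotient.mk 𝔟 (x i)) ↔
        Module.length A (KoszulHomology x (A ⧸ 𝔟) 2) <
          Module.length A
            (CanonicalModule 𝔟 ⧸ (𝔞 • ⊤ : Submodule A (CanonicalModule 𝔟)))) ∧
    (∀ (f : KoszulHomology x (A ⧸ 𝔟) 2 →ₗ[A]
            CanonicalModule 𝔟 ⧸ (𝔞 • ⊤ : Submodule A (CanonicalModule 𝔟)))
        (g : (CanonicalModule 𝔟 ⧸ (𝔞 • ⊤ : Submodule A (CanonicalModule 𝔟))) →ₗ[A]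
            CanonicalModule (𝔟 ⊔ 𝔞))
        (h : CanonicalModule (𝔟 ⊔ 𝔞) →ₗ[A] KoszulHomology x (A ⧸ 𝔟) 1),
        Function.Injective f → Function.Exact f g → Function.Exact g h →
          Function.Surjective h →
        (SatisfiesMonomialConjecture (fun i => Ideal.Quotient.mk 𝔟 (x i)) ↔ g ≠ 0)) := by
  subst h𝔞
  obtain ⟨ys, hys⟩ : ∃ ys, ys = List.ofFn (Fin.init y) := ⟨_, rfl⟩
  obtain ⟨l, hl⟩ : ∃ l, l = y (Fin.last n) := ⟨_, rfl⟩
  have hlen : ys.length = n := by rw [hys, List.length_ofFn]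
  rw [span_range_eq_span_last_sup, ← hys, ← hl] at h𝔟
  rw [← hys] at hreg
  rw [← hlen] at hdim
  obtain ⟨hps, hdim0⟩ := IsParameterSystem.of_isRegular hreg hdim
  -- Regular sequences in a Noetherian local ring may be permuted; with `ys` in front, `x` is
  -- regular on `A/(ys)`.
  have hregys : RingTheory.Sequence.IsRegular A (ys ++ List.ofFn x) :=
    IsLocalRing.isRegular_of_perm hreg List.perm_append_comm
  obtain ⟨hyreg, hxreg⟩ :=
    (RingTheory.Sequence.isWeaklyRegular_append_iff _ _ _).mp hregys.toIsWeaklyRegular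
  replace hxreg : RingTheory.Sequence.IsWeaklyRegular (A ⧸ Ideal.ofList ys) (List.ofFn x) :=
    ((Submodule.quotEquivOfEq (Ideal.ofList ys • (⊤ : Submodule A A)) (Ideal.ofList ys)
      (by simp)).isWeaklyRegular_congr _).mp hxreg
  have hlreg : ¬ IsSMulRegular (A ⧸ Ideal.ofList ys) l :=
    not_isSMulRegular_of_height_le hyreg (by rw [← h𝔟, hht𝔟, hlen])
  have h𝔟top : 𝔟 ≠ ⊤ := by
    rintro rfl
    rw [Ideal.height_top] at hht𝔟
    exact ENat.top_ne_natCast n hht𝔟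
  have := Ideal.Quotient.nontrivial_iff.mpr h𝔟top
  have hdimR : ringKrullDim (A ⧸ 𝔟) = d := by
    rw [h𝔟]
    exact hps.ringKrullDim_quotient_eq hxreg hlreg
  set X := Ideal.span (Set.range x) with hX
  have hysle : Ideal.ofList ys ≤ 𝔟 := h𝔟 ▸ le_sup_right
  -- the canonical modules
  obtain ⟨e⟩ := nonempty_canonicalModule_equiv_ker h𝔟 hyreg (quotientCodim_eq hdim hdimR)
  have hsup : 𝔟 ⊔ X = Ideal.span {l} ⊔ Ideal.ofList (List.ofFn x ++ ys) := by
    rw [h𝔟, Ideal.ofList_append, ofList_ofFn, sup_assoc, sup_comm (Ideal.ofList ys)]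
  have hsuptop : 𝔟 ⊔ X ≠ ⊤ := by
    have hle : 𝔟 ⊔ X ≤ IsLocalRing.maximalIdeal A := sup_le (IsLocalRing.le_maximalIdeal h𝔟top)
      (Ideal.span_le.mpr (by rintro _ ⟨i, rfl⟩; exact hps.mem_x i))
    exact fun htop => (IsLocalRing.maximalIdeal.isMaximal A).ne_top (top_le_iff.mp (htop ▸ hle))
  have hdimsup : ringKrullDim (A ⧸ (𝔟 ⊔ X)) = ((0 : ℕ) : WithBot ℕ∞) := by
    have hle : X ⊔ Ideal.ofList ys ≤ 𝔟 ⊔ X := sup_le le_sup_right (hysle.trans le_sup_left)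
    have := Ideal.Quotient.nontrivial_iff.mpr hsuptop
    refine le_antisymm ?_ ringKrullDim_nonneg_of_nontrivial
    refine (ringKrullDim_le_of_surjective (Ideal.Quotient.factor hle)
      (Ideal.Quotient.factor_surjective hle)).trans ?_
    rw [hdim0]
    exact le_rfl
  -- `R/𝔞` has dimension `0`, so its codimension is `dim A`, the length of the whole sequence `x,
  -- ys`.
  obtain ⟨e'⟩ := nonempty_canonicalModule_equiv_ker hsup hreg.toIsWeaklyRegular
    (quotientCodim_eq (by rw [hdim, zero_add, List.length_append, List.length_ofFn]) hdimsup)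
  exact hps.koszul_comparison hdim h𝔟 h𝔟top hxreg hlreg e e'
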